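/- Let $G$ be a compact (Hausdorff) group with neutral element $e$ and normalized Haar measure $dg$. Let $(\mu_t,\,t\ge 0)$ be a vaguely continuous convolution semigroup of Borel probability measures on $G$ with $\mu_0=\delta_e$, such that every $\mu_t$ is central ($\mu_t(\sigma A\sigma^{-1})=\mu_t(A)$ for all $\sigma\in G$ and all Borel sets $A$) and symmetric ($\mu_t(A^{-1})=\mu_t(A)$ for all Borel sets $A$), and such that for every $t>0$ the measure $\mu_t$ is absolutely continuous with respect to Haar measure with a density in $L^2(G,\mathbb R)$. Let $\widehat G$ be the set of equivalence classes of irreducible (continuous, unitary) representations of $G$, and let $\chi_\pi=\operatorname{tr}\pi(\cdot)$ for $\pi\in\widehat G$. Let $T_t$ be the bounded operator on $L^2(G)=L^2(G,\mathbb C)$ extending $T_tf(\sigma)=\int_G f(\sigma\tau)\,\mu_t(d\tau)$, $f\in C(G)$, and let $L^2_c(G)$ be the space of all $f\in L^2(G)$ with $f(g\sigma g^{-1})=f(\sigma)$ for all $g\in G$ (for each $g$, for almost every $\sigma$); it is invariant under $T_t$. Then there are real numbers $\alpha_\pi\le 0$ ($\pi\in\widehat G$) with $\int_G\pi(\sigma)\,\mu_t(d\sigma)=e^{t\alpha_\pi}I_\pi$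 for all $t\ge 0$ and $\pi\in\widehat G$. For each $t>0$, the measure $\mu_t$ has exactly one continuous density $k_t$, and, with $h_t(\sigma,\tau)=k_t(\sigma^{-1}\tau)$: 1. for all $\sigma,\rho\in G$, $$\int_G h_t(g^{-1}\sigma,\rho g^{-1})\,dg=\sum_{\pi\in\widehat G}e^{t\alpha_\pi}\,\overline{\chi_\pi(\sigma)}\,\chi_\pi(\rho),$$ where the series converges absolutely; 2. the restriction of $T_t$ to the Hilbert space $L^2_c(G)$ is of trace class, and its trace is $$\operatorname{tr}(T_t)=\int_G\int_G k_t(\rho^{-1}g\rho g^{-1})\,dg\,d\rho .$$ -/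

import Mathlib

open MeasureTheory Topology Filter
open scoped NNReal ENNReal ComplexConjugate

namespace CentralSemigroup

universe u

/-! ### Irreducible unitary representations and the unitary dual -/

/-- The linear representation on `ℂⁿ` given by a homomorphism into the unitary matrices. -/
def unitaryRep {G : Type u} [Group G] {n : ℕ} (π : G →* Matrix.unitaryGroup (Fin n) ℂ) :
    Representation ℂ G (Fin n → ℂ) :=
  (Matrix.toLinAlgEquiv' (R := ℂ) (n := Fin n)).toMonoidHom.comp
    ((Matrix.unitaryGroup (Fin n) ℂ).subtype.comp π)

/-- A continuous irreducible unitary matrix representation of `G` on `ℂⁿ`, where `n = dim`. -/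
structure Irrep (G : Type u) [Group G] [TopologicalSpace G] where
  /-- the dimension `d_π` -/
  dim : ℕ
  /-- the representation `σ ↦ π(σ)` by unitary matrices -/
  hom : G →* Matrix.unitaryGroup (Fin dim) ℂ
  continuous_hom : Continuous hom
  irreducible : (unitaryRep hom).IsIrreducible

section Dual

variable {G : Type u} [Group G] [TopologicalSpace G]

/-- The matrix `π(σ)`. -/
def Irrep.mat (π : Irrep G) (σ : G) : Matrix (Fin π.dim) (Fin π.dim) ℂ := (π.hom σ).1

/-- The linear representation on `ℂⁿ` given by the matrices `π(σ)`. -/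
def Irrep.rep (π : Irrep G) : Representation ℂ G (Fin π.dim → ℂ) := unitaryRep π.hom

/-- The character `σ ↦ tr π(σ)`. -/
def Irrep.char (π : Irrep G) (σ : G) : ℂ := (π.mat σ).trace

theorem Irrep.rep_character (π : Irrep G) : π.rep.character = π.char := by
  ext σ
  change LinearMap.trace ℂ _ (Matrix.toLin' (π.mat σ)) = (π.mat σ).trace
  exact Matrix.trace_toLin'_eq _

/-- Equivalence of representations. -/
instance irrepSetoid (G : Type u) [Group G] [TopologicalSpace G] : Setoid (Irrep G) where
  r π π' := Nonempty (Representation.Equiv π.rep π'.rep)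
  iseqv := ⟨fun _ => ⟨.refl _⟩, fun ⟨e⟩ => ⟨e.symm⟩, fun ⟨e⟩ ⟨e'⟩ => ⟨e.trans e'⟩⟩

/-- The dual `Ĝ`: equivalence classes of irreducible unitary representations. -/
def Dual (G : Type u) [Group G] [TopologicalSpace G] : Type u := Quotient (irrepSetoid G)

/-- The class in `Ĝ` of an irreducible representation. -/
def Irrep.toDual (π : Irrep G) : Dual G := Quotient.mk (irrepSetoid G) π

/-- The character `χ_π` of a class `π ∈ Ĝ`. -/
def chi (p : Dual G) : G → ℂ :=
  Quotient.lift (s := irrepSetoid G) Irrep.char (by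
    rintro π π' ⟨e⟩
    rw [← Irrep.rep_character, ← Irrep.rep_character]
    exact Representation.char_iso e) p

/-- The Fourier transform `∫ π(σ) μ(dσ)` of a measure, computed entrywise. -/
noncomputable def measureFourier [MeasurableSpace G] (μ : Measure G) (π : Irrep G) :
    Matrix (Fin π.dim) (Fin π.dim) ℂ :=
  Matrix.of fun i j => ∫ σ, π.mat σ i j ∂μ

end Dual

/-! ### Measures on `G` -/

section Measures

variable {G : Type u} [Group G] [TopologicalSpace G] [MeasurableSpace G]

/-- `μ(σ A σ⁻¹) = μ(A)` for all `σ ∈ G` and all Borel sets `A`. -/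
def IsCentral (μ : Measure G) : Prop :=
  ∀ (σ : G) (A : Set G), MeasurableSet A → μ ((fun x => σ * x * σ⁻¹) '' A) = μ A

/-- `μ(A⁻¹) = μ(A)` for all Borel sets `A`. -/
def IsSymmetric (μ : Measure G) : Prop :=
  ∀ A : Set G, MeasurableSet A → μ ((fun x => x⁻¹) '' A) = μ A

/-- A weakly continuous convolution semigroup `(μ_t, t ≥ 0)` of probability measures on `G`
with `μ_0 = δ_e`. (On a compact group weak and vague continuity agree.) The convolution
`μ_s * μ_t` is the functional `f ↦ ∫∫ f(xy) μ_t(dy) μ_s(dx)` on continuous functions: on a group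
whose topology is not second countable, multiplication need not be measurable for the product
σ-algebra, so that the image measure of `μ_s × μ_t` is not available there. -/
structure IsConvolutionSemigroup [OpensMeasurableSpace G] (μ : ℝ≥0 → ProbabilityMeasure G) :
    Prop where
  zero : (μ 0 : Measure G) = Measure.dirac 1
  add : ∀ (s t : ℝ≥0) (f : C(G, ℝ)),
    ∫ x, f x ∂(μ (s + t) : Measure G) =
      ∫ x, ∫ y, f (x * y) ∂(μ t : Measure G) ∂(μ s : Measure G)
  continuous : Continuous μ

end Measures

section Haar

variable (G : Type u) [Group G] [TopologicalSpace G] [IsTopologicalGroup G] [CompactSpace G]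
  [MeasurableSpace G] [BorelSpace G]

/-- Normalized Haar measure. -/
noncomputable def haarProb : Measure G := Measure.haarMeasure ⊤

instance : (haarProb G).IsHaarMeasure := by unfold haarProb; infer_instance

instance : IsProbabilityMeasure (haarProb G) := ⟨by
  have h := Measure.haarMeasure_self (K₀ := (⊤ : TopologicalSpace.PositiveCompacts G))
  simpa [haarProb] using h⟩

instance : (haarProb G).IsMulRightInvariant := ⟨fun g => by
  have : IsProbabilityMeasure (Measure.map (· * g) (haarProb G)) :=
    Measure.isProbabilityMeasure_map (measurable_mul_const g).aemeasurable
  exact Measure.isHaarMeasure_eq_of_isProbabilityMeasure _ _⟩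

variable {G}

/-- `μ` has a square-integrable density: it is absolutely continuous with respect to normalized
Haar measure and its Radon-Nikodym derivative is in `L²(G, ℝ)`. -/
def HasL2Density (μ : Measure G) : Prop :=
  μ ≪ haarProb G ∧ MemLp (fun σ => (μ.rnDeriv (haarProb G) σ).toReal) 2 (haarProb G)

/-- `k` is a version of the density of `μ` with respect to normalized Haar measure. -/
def IsDensity (μ : Measure G) (k : G → ℝ) : Prop :=
  μ ≪ haarProb G ∧ k =ᵐ[haarProb G] fun σ => (μ.rnDeriv (haarProb G) σ).toReal

/-! ### The Hunt semigroup on `L²(G)` and on its central subspace -/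

variable (G) in
/-- `L²(G) = L²(G, ℂ)` for normalized Haar measure. -/
abbrev L2 : Type u := Lp ℂ 2 (haarProb G)

/-- Right translation `(R_τ f)(σ) = f(σ τ)` on `L²(G)`. -/
noncomputable def rightTranslation (τ : G) : L2 G →ₗᵢ[ℂ] L2 G :=
  Lp.compMeasurePreservingₗᵢ ℂ (· * τ) (measurePreserving_mul_right (haarProb G) τ)

theorem continuous_rightTranslation (f : L2 G) :
    Continuous fun τ : G => rightTranslation τ f := by
  let g : G → C(G, G) := (ContinuousMap.curry ⟨fun p : G × G => p.2 * p.1, by fun_prop⟩ : C(G, C(G, G)))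
  have hg : Continuous g := ContinuousMap.continuous _
  exact Continuous.compMeasurePreservingLp (f := fun _ : G => f) continuous_const hg
    (fun τ => measurePreserving_mul_right (haarProb G) τ) (by simp)

theorem integrable_rightTranslation (μ : Measure G) [IsFiniteMeasure μ] (f : L2 G) :
    Integrable (fun τ : G => rightTranslation τ f) μ :=
  (continuous_rightTranslation f).integrable_of_hasCompactSupport
    (HasCompactSupport.of_compactSpace _)

/-- The operator `T f(σ) = ∫ f(σ τ) μ(dτ)` on `L²(G)`, that is `T = ∫ R_τ μ(dτ)`. -/
noncomputable def hunt (μ : Measure G) [IsProbabilityMeasure μ] : L2 G →L[ℂ] L2 G :=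
  LinearMap.mkContinuous
    { toFun := fun f => ∫ τ, rightTranslation τ f ∂μ
      map_add' := fun f g => by
        simp only [map_add]
        exact integral_add (integrable_rightTranslation μ f) (integrable_rightTranslation μ g)
      map_smul' := fun c f => by
        simp only [map_smul, RingHom.id_apply]
        exact integral_smul c _ }
    1 (fun f => by
      have h := norm_integral_le_of_norm_le_const (μ := μ) (C := ‖f‖)
        (f := fun τ : G => rightTranslation τ f)
        (Eventually.of_forall fun τ => ((rightTranslation τ).norm_map f).le)
      simpa using h)

theorem hunt_apply (μ : Measure G) [IsProbabilityMeasure μ] (f : L2 G) :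
    hunt μ f = ∫ τ, rightTranslation τ f ∂μ := rfl

/-- On continuous functions `hunt μ` is given by the integral formula; as `C(G)` is dense in
`L²(G)`, the operator `hunt μ` is the continuous extension of the one on `C(G)`. -/
theorem hunt_continuousMap (μ : Measure G) [IsProbabilityMeasure μ] (f : C(G, ℂ)) :
    hunt μ (ContinuousMap.toLp 2 (haarProb G) ℂ f) =ᵐ[haarProb G]
      fun σ => ∫ τ, f (σ * τ) ∂μ := by
  let F : C(G, C(G, ℂ)) := ContinuousMap.curry ⟨fun p : G × G => f (p.2 * p.1), by fun_prop⟩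
  have hF : Integrable F μ := F.continuous.integrable_of_hasCompactSupport
    (HasCompactSupport.of_compactSpace _)
  have h1 : ∀ τ, rightTranslation τ (ContinuousMap.toLp 2 (haarProb G) ℂ f) =
      ContinuousMap.toLp (E := ℂ) 2 (haarProb G) ℂ (F τ) := fun τ => by
    apply Lp.ext
    refine (Lp.coeFn_compMeasurePreserving _
      (measurePreserving_mul_right (haarProb G) τ)).trans ?_
    have h2 := (measurePreserving_mul_right (haarProb G) τ).quasiMeasurePreserving.ae_eq_comp
      (ContinuousMap.coeFn_toLp (p := 2) (𝕜 := ℂ) (haarProb G) f)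
    refine h2.trans ?_
    exact (ContinuousMap.coeFn_toLp (p := 2) (𝕜 := ℂ) (haarProb G) (F τ)).symm
  have h3 : hunt μ (ContinuousMap.toLp 2 (haarProb G) ℂ f) =
      ContinuousMap.toLp (E := ℂ) 2 (haarProb G) ℂ (∫ τ, F τ ∂μ) := by
    rw [hunt_apply]
    simp only [h1]
    exact ContinuousLinearMap.integral_comp_comm _ hF
  rw [h3]
  refine (ContinuousMap.coeFn_toLp (p := 2) (𝕜 := ℂ) (haarProb G) _).trans ?_
  refine Eventually.of_forall fun σ => ?_
  exact (ContinuousLinearMap.integral_comp_comm (ContinuousMap.evalCLM ℂ σ) hF).symm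

theorem measurePreserving_conj (g : G) :
    MeasurePreserving (fun σ : G => g * σ * g⁻¹) (haarProb G) (haarProb G) :=
  (measurePreserving_mul_right (haarProb G) g⁻¹).comp (measurePreserving_mul_left (haarProb G) g)

/-- Composition with conjugation, `(C_g f)(σ) = f(g σ g⁻¹)`, on `L²(G)`. -/
noncomputable def conjTranslation (g : G) : L2 G →ₗᵢ[ℂ] L2 G :=
  Lp.compMeasurePreservingₗᵢ ℂ (fun σ : G => g * σ * g⁻¹) (measurePreserving_conj g)

theorem conjTranslation_ae (g : G) (f : L2 G) :
    conjTranslation g f =ᵐ[haarProb G] fun σ => f (g * σ * g⁻¹) :=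
  Lp.coeFn_compMeasurePreserving f (measurePreserving_conj g)

variable (G) in
/-- The central subspace `L²_c(G)`: all `f ∈ L²(G)` with `f(g σ g⁻¹) = f(σ)`. -/
noncomputable def L2c : Submodule ℂ (L2 G) where
  carrier := {f | ∀ g : G, (fun σ => f (g * σ * g⁻¹)) =ᵐ[haarProb G] f}
  zero_mem' := fun g => (conjTranslation_ae g 0).symm.trans (by rw [map_zero])
  add_mem' := fun {a b} ha hb g => by
    have ha' : conjTranslation g a = a := Lp.ext ((conjTranslation_ae g a).trans (ha g))
    have hb' : conjTranslation g b = b := Lp.ext ((conjTranslation_ae g b).trans (hb g))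
    exact (conjTranslation_ae g _).symm.trans (by rw [map_add, ha', hb'])
  smul_mem' := fun c a ha g => by
    have ha' : conjTranslation g a = a := Lp.ext ((conjTranslation_ae g a).trans (ha g))
    exact (conjTranslation_ae g _).symm.trans (by rw [map_smul, ha'])

theorem mem_L2c_iff (f : L2 G) : f ∈ L2c G ↔ ∀ g : G, conjTranslation g f = f :=
  forall_congr' fun g =>
    ⟨fun h => Lp.ext ((conjTranslation_ae g f).trans h),
      fun h => (conjTranslation_ae g f).symm.trans (by rw [h])⟩

theorem isClosed_L2c : IsClosed (L2c G : Set (L2 G)) := by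
  have : (L2c G : Set (L2 G)) = ⋂ g : G, {f | conjTranslation g f = f} := by
    ext f; simp [mem_L2c_iff]
  rw [this]
  exact isClosed_iInter fun g => isClosed_eq (conjTranslation g).continuous continuous_id

instance : CompleteSpace (L2c G) := isClosed_L2c.completeSpace_coe

theorem conj_rightTranslation (g τ : G) (f : L2 G) :
    conjTranslation g (rightTranslation τ f) =
      rightTranslation (g⁻¹ * τ * g) (conjTranslation g f) := by
  have h1 := Lp.compMeasurePreserving_comp_apply f
    (measurePreserving_mul_right (haarProb G) τ) (measurePreserving_conj g)
  have h2 := Lp.compMeasurePreserving_comp_apply f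
    (measurePreserving_conj g) (measurePreserving_mul_right (haarProb G) (g⁻¹ * τ * g))
  have h3 : ∀ (φ ψ : G → G) (hφ : MeasurePreserving φ (haarProb G) (haarProb G))
      (hψ : MeasurePreserving ψ (haarProb G) (haarProb G)), φ = ψ →
      Lp.compMeasurePreserving φ hφ f = Lp.compMeasurePreserving ψ hψ f := by
    rintro φ _ _ _ rfl
    rfl
  refine h1.symm.trans (Eq.trans (h3 _ _ _ _ ?_) h2)
  funext σ
  simp [mul_assoc]

theorem IsCentral.map_conj {μ : Measure G} (h : IsCentral μ) (g : G) :
    μ.map (fun x => g⁻¹ * x * g) = μ := by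
  ext A hA
  rw [Measure.map_apply (by fun_prop) hA, ← h g A hA]
  congr 1
  ext x
  constructor
  · intro hx
    exact ⟨_, hx, by simp [mul_assoc]⟩
  · rintro ⟨y, hy, rfl⟩
    simpa [mul_assoc] using hy

/-- If `μ` is central then `T` maps `L²_c(G)` into itself. -/
theorem hunt_mem_L2c {μ : Measure G} [IsProbabilityMeasure μ] (h : IsCentral μ) {f : L2 G}
    (hf : f ∈ L2c G) : hunt μ f ∈ L2c G := by
  rw [mem_L2c_iff] at hf ⊢
  intro g
  rw [hunt_apply]
  have h1 := (conjTranslation g).toContinuousLinearMap.integral_comp_comm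
    (integrable_rightTranslation μ f)
  simp only [LinearIsometry.coe_toContinuousLinearMap, conj_rightTranslation, hf g] at h1
  rw [← h1]
  have hm : AEMeasurable (fun x : G => g⁻¹ * x * g) μ := by fun_prop
  have hi := integrable_rightTranslation (μ.map (fun x : G => g⁻¹ * x * g)) f
  have h2 := integral_map hm hi.aestronglyMeasurable
  rw [← h2, h.map_conj g]

/-- The action of `T` on `L²_c(G)`, for central `μ`. -/
noncomputable def huntCentral (μ : Measure G) [IsProbabilityMeasure μ] (h : IsCentral μ) :
    L2c G →L[ℂ] L2c G :=
  ((hunt μ).comp (L2c G).subtypeL).codRestrict (L2c G) fun f => hunt_mem_L2c h f.2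

/-- The transition density `h(σ, τ) = k(σ⁻¹ τ)`. -/
def transitionDensity (k : G → ℝ) (σ τ : G) : ℝ := k (σ⁻¹ * τ)

end Haar

/-! ### Traces -/

section Trace

variable {H : Type u} [NormedAddCommGroup H] [InnerProductSpace ℂ H]

/-- `T` is a trace-class (equivalently, nuclear) operator: `T = ∑ₙ ⟨bₙ, ·⟩ aₙ` with
`∑ₙ ‖aₙ‖ ‖bₙ‖ < ∞`. -/
def IsTraceClass (T : H →L[ℂ] H) : Prop :=
  ∃ a b : ℕ → H, Summable (fun n => ‖a n‖ * ‖b n‖) ∧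
    ∀ x, HasSum (fun n => inner ℂ (b n) x • a n) (T x)

/-- `T` is a trace-class operator with trace `τ`: the sum `∑ ⟨e, T e⟩` over every complete
orthonormal basis converges to `τ`. Orthonormal bases are indexed by subsets of `H`, which is no
restriction. -/
def HasTrace (T : H →L[ℂ] H) (τ : ℂ) : Prop :=
  IsTraceClass T ∧ ∀ (w : Set H) (e : HilbertBasis w ℂ H),
    HasSum (fun i => inner ℂ (e i) (T (e i))) τ

end Trace

end CentralSemigroup

open CentralSemigroup

/-! A square-integrable density `κ` turns `T = hunt μ` into an operator with continuous values, `T f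
(σ) = ⟨L_σ κ, f⟩`; Arzelà–Ascoli then makes `T` compact (`HasL2Density.isCompactOperator_hunt`).
Symmetry of `μ` makes `T` self-adjoint and centrality makes it commute with right translations.
Completeness of the characters is proved from these facts. On the orthogonal complement of all
matrix coefficients a nonzero eigenvalue would have a finite-dimensional, right-invariant
eigenspace, hence an irreducible piece, whose vectors are themselves combinations of matrix
coefficients; so `T` vanishes there (`HasL2Density.hunt_eq_zero`). Since `⟨f, T_t f⟩ → ‖f‖²` as `t →
0`, a vector killed by every `T_t` is zero, and the characters form a Hilbert basis of `L²_c(G)`.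

By Schur's lemma a central measure has scalar Fourier transforms. For the semigroup these scalars
are real, continuous and multiplicative in `t` and bounded by 1, hence equal to `exp (t α_p)` with
`α_p ≤ 0`.

For `t = 2s` let `κ` be the density of `μ_s`. Then `k_t(x) = ⟨L_x κ, κ⟩` is continuous, and the
average of `k_t(σ⁻¹ g ρ g⁻¹)` over `g` is the inner product of the central projections of two
translates of `κ`. Parseval in the basis of characters is the stated expansion
(`IsConvolutionSemigroup.hasSum_integral_density`). At `σ = ρ = 1` it makes the eigenvalues
summable, and integration over `σ = ρ` with `∫ |χ_p|² = 1` gives the trace (`hasTrace_huntCentral`).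
-/

namespace CentralSemigroup

universe u

/-! ### Matrix representations and Schur's lemma -/

section Matrices

variable {G : Type u} [Group G] [TopologicalSpace G]

namespace Irrep

variable (π π' : Irrep G)

theorem mat_mul (σ τ : G) : π.mat (σ * τ) = π.mat σ * π.mat τ := by
  simp [mat]

theorem mat_one : π.mat 1 = 1 := by
  simp [mat]

theorem mat_mul_conjTranspose (σ : G) : π.mat σ * (π.mat σ).conjTranspose = 1 :=
  Matrix.mem_unitaryGroup_iff.1 (π.hom σ).2

theorem conjTranspose_mul_mat (σ : G) : (π.mat σ).conjTranspose * π.mat σ = 1 :=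
  Matrix.mem_unitaryGroup_iff'.1 (π.hom σ).2

theorem mat_inv (σ : G) : π.mat σ⁻¹ = (π.mat σ).conjTranspose := by
  have h : π.mat σ⁻¹ * π.mat σ = 1 := by rw [← mat_mul, inv_mul_cancel, mat_one]
  calc π.mat σ⁻¹ = π.mat σ⁻¹ * (π.mat σ * (π.mat σ).conjTranspose) := by
        rw [mat_mul_conjTranspose, mul_one]
    _ = (π.mat σ).conjTranspose := by rw [← mul_assoc, h, one_mul]

theorem mat_inv_apply (σ : G) (i j : Fin π.dim) : π.mat σ⁻¹ i j = conj (π.mat σ j i) := by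
  rw [mat_inv]; rfl

theorem mat_mul_apply (σ τ : G) (i j : Fin π.dim) :
    π.mat (σ * τ) i j = ∑ k, π.mat σ i k * π.mat τ k j := by
  rw [mat_mul, Matrix.mul_apply]

theorem rep_apply (σ : G) (v : Fin π.dim → ℂ) : π.rep σ v = (π.mat σ).mulVec v := rfl

theorem continuous_mat : Continuous π.mat :=
  continuous_subtype_val.comp π.continuous_hom

theorem continuous_mat_apply (i j : Fin π.dim) : Continuous fun σ => π.mat σ i j :=
  π.continuous_mat.matrix_elem i j

theorem continuous_char : Continuous π.char :=
  π.continuous_mat.matrix_trace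

/-- The matrix coefficient `π_ij` as a continuous function. -/
def coeff (i j : Fin π.dim) : C(G, ℂ) := ⟨fun σ => π.mat σ i j, π.continuous_mat_apply i j⟩

@[simp] theorem coeff_apply (i j : Fin π.dim) (σ : G) : π.coeff i j σ = π.mat σ i j := rfl

instance : Representation.IsIrreducible π.rep := π.irreducible

theorem dim_pos : 0 < π.dim := by
  by_contra h
  have h0 : π.dim = 0 := by omega
  have : IsEmpty (Fin π.dim) := by rw [h0]; infer_instance
  obtain ⟨a, b, hab⟩ := π.irreducible.toNontrivial
  exact hab (Subrepresentation.toSubmodule_injective (Subsingleton.elim _ _))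

theorem char_one : π.char 1 = π.dim := by
  simp [char, mat_one]

/-- **Schur's lemma**: a matrix commuting with an irreducible representation is scalar. -/
theorem exists_eq_smul_one {A : Matrix (Fin π.dim) (Fin π.dim) ℂ}
    (h : ∀ σ, π.mat σ * A = A * π.mat σ) : ∃ c : ℂ, A = c • 1 := by
  let f : Representation.IntertwiningMap π.rep π.rep :=
    LinearMap.intertwiningMap_of_isIntertwiningMap _ _ (Matrix.toLin' A) fun g v => by
      rw [rep_apply, rep_apply, Matrix.toLin'_apply, Matrix.toLin'_apply, Matrix.mulVec_mulVec,
        Matrix.mulVec_mulVec, h]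
  obtain ⟨c, hc⟩ :=
    (Representation.IsIrreducible.algebraMap_intertwiningMap_bijective_of_isAlgClosed
      (ρ := π.rep)).2 f
  refine ⟨c, Matrix.toLin'.injective (LinearMap.ext fun v => ?_)⟩
  have h1 : f v = c • v := by rw [← hc]; rfl
  change f v = _
  simpa using h1

variable {π π'} in
/-- **Schur's lemma**: inequivalent irreducible representations have no intertwiner. -/
theorem eq_zero_of_intertwines (hne : ¬ π ≈ π') {A : Matrix (Fin π.dim) (Fin π'.dim) ℂ}
    (h : ∀ σ, π.mat σ * A = A * π'.mat σ) : A = 0 := by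
  let f : Representation.IntertwiningMap π'.rep π.rep :=
    LinearMap.intertwiningMap_of_isIntertwiningMap _ _ (Matrix.toLin' A) fun g v => by
      rw [rep_apply, rep_apply, Matrix.toLin'_apply, Matrix.toLin'_apply, Matrix.mulVec_mulVec,
        Matrix.mulVec_mulVec, h]
  have : IsEmpty (Representation.Equiv π'.rep π.rep) := ⟨fun e => hne ⟨e.symm⟩⟩
  have h1 : f = 0 := Subsingleton.elim _ _
  refine Matrix.toLin'.injective (LinearMap.ext fun v => ?_)
  have h2 : f v = 0 := by rw [h1]; rfl
  change f v = _
  simpa using h2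

end Irrep

theorem chi_toDual (π : Irrep G) : chi π.toDual = π.char := rfl

theorem exists_toDual_eq (p : Dual G) : ∃ π : Irrep G, π.toDual = p := Quotient.exists_rep p

theorem toDual_eq_iff (π π' : Irrep G) : π.toDual = π'.toDual ↔ π ≈ π' :=
  Quotient.eq (r := irrepSetoid G)

end Matrices

/-! ### Schur orthogonality of coefficients and characters -/

section Orthogonality

variable {G : Type u} [Group G] [TopologicalSpace G] [IsTopologicalGroup G] [CompactSpace G]
  [MeasurableSpace G] [BorelSpace G]

omit [Group G] [IsTopologicalGroup G] in
theorem integrable_of_continuous {E : Type*} [NormedAddCommGroup E]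
    (μ : Measure G) [IsFiniteMeasure μ] {f : G → E} (hf : Continuous f) : Integrable f μ :=
  hf.integrable_of_hasCompactSupport (HasCompactSupport.of_compactSpace _)

namespace Irrep

variable (π π' : Irrep G)

/-- The integrals `∫ π_ia conj(π'_jb)`, as a matrix in `i`, `j`. -/
noncomputable def schurMatrix (a : Fin π.dim) (b : Fin π'.dim) :
    Matrix (Fin π.dim) (Fin π'.dim) ℂ :=
  Matrix.of fun i j => ∫ σ, π.mat σ i a * conj (π'.mat σ j b) ∂haarProb G

theorem integrable_coeff_mul_conj (i a : Fin π.dim) (j b : Fin π'.dim) :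
    Integrable (fun σ => π.mat σ i a * conj (π'.mat σ j b)) (haarProb G) :=
  integrable_of_continuous _ ((π.continuous_mat_apply i a).mul
    (Complex.continuous_conj.comp (π'.continuous_mat_apply j b)))

/-- Left invariance of Haar measure, through the substitution `σ ↦ τ⁻¹σ`, moves `τ` from one factor
to the other. Schur's lemma then applies to these integrals. -/
theorem mat_mul_schurMatrix (a : Fin π.dim) (b : Fin π'.dim) (τ : G) :
    π.mat τ * schurMatrix π π' a b = schurMatrix π π' a b * π'.mat τ := by
  ext i j
  have h1 : (π.mat τ * schurMatrix π π' a b) i j =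
      ∫ σ, π.mat (τ * σ) i a * conj (π'.mat σ j b) ∂haarProb G := by
    simp only [Matrix.mul_apply, schurMatrix, Matrix.of_apply, mat_mul, Finset.sum_mul]
    rw [integral_finsetSum]
    · simp_rw [mul_assoc, integral_const_mul]
    · intro k _
      simp_rw [mul_assoc]
      exact (integrable_coeff_mul_conj π π' k a j b).const_mul _
  have h2 : (schurMatrix π π' a b * π'.mat τ) i j =
      ∫ σ, π.mat σ i a * conj (π'.mat (τ⁻¹ * σ) j b) ∂haarProb G := by
    simp only [Matrix.mul_apply, schurMatrix, Matrix.of_apply, mat_mul, map_sum, map_mul,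
      Finset.mul_sum, mat_inv_apply, Complex.conj_conj]
    rw [integral_finsetSum]
    · refine Finset.sum_congr rfl fun k _ => ?_
      rw [← integral_mul_const]
      congr 1; ext σ; ring
    · intro k _
      refine ((integrable_coeff_mul_conj π π' i a k b).const_mul (π'.mat τ k j)).congr ?_
      exact Eventually.of_forall fun σ => by simp only; ring
  rw [h1, h2, ← integral_mul_left_eq_self _ τ⁻¹]
  simp

variable {π π'} in
theorem integral_coeff_mul_conj_of_not_equiv (hne : ¬ π ≈ π') (i a : Fin π.dim)
    (j b : Fin π'.dim) : ∫ σ, π.mat σ i a * conj (π'.mat σ j b) ∂haarProb G = 0 :=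
  congrFun (congrFun (eq_zero_of_intertwines hne (mat_mul_schurMatrix π π' a b)) i) j

/-- **Schur orthogonality relations**. -/
theorem integral_coeff_mul_conj (i a j b : Fin π.dim) :
    ∫ σ, π.mat σ i a * conj (π.mat σ j b) ∂haarProb G =
      if i = j ∧ a = b then (π.dim : ℂ)⁻¹ else 0 := by
  obtain ⟨c, hc⟩ := π.exists_eq_smul_one (mat_mul_schurMatrix π π a b)
  have hd : (π.dim : ℂ) ≠ 0 := Nat.cast_ne_zero.2 π.dim_pos.ne'
  -- The trace fixes the scalar `c`: the columns of a unitary matrix are orthonormal, so the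
  -- integrand summed over `k` is the constant `δ_ab`, while the trace of `c • 1` is `c * π.dim`.
  have h1 : (schurMatrix π π a b).trace = if a = b then 1 else 0 := by
    simp only [Matrix.trace, Matrix.diag, schurMatrix, Matrix.of_apply]
    rw [← integral_finsetSum _ fun k _ => integrable_coeff_mul_conj π π k a k b]
    have h2 : ∀ σ, ∑ k, π.mat σ k a * conj (π.mat σ k b) = if a = b then 1 else 0 := fun σ => by
      have := congrFun (congrFun (π.conjTranspose_mul_mat σ) b) a
      rw [Matrix.mul_apply, Matrix.one_apply] at this
      simp only [Matrix.conjTranspose_apply, RCLike.star_def] at this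
      simp only [eq_comm (a := b)] at this
      rw [← this]
      exact Finset.sum_congr rfl fun k _ => mul_comm _ _
    simp [h2]
  have h3 : c = if a = b then (π.dim : ℂ)⁻¹ else 0 := by
    rw [hc, Matrix.trace_smul, Matrix.trace_one, Fintype.card_fin, smul_eq_mul] at h1
    split_ifs at h1 ⊢ with hab
    · field_simp; exact h1
    · simpa [hd] using h1
  have h4 := congrFun (congrFun hc i) j
  rw [schurMatrix, Matrix.of_apply] at h4
  rw [h4, h3, Matrix.smul_apply, Matrix.one_apply]
  by_cases hij : i = j <;> by_cases hab : a = b <;> simp [hij, hab]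

open scoped Classical in
theorem integral_char_mul_conj :
    ∫ σ, π.char σ * conj (π'.char σ) ∂haarProb G = if π.toDual = π'.toDual then 1 else 0 := by
  split_ifs with h
  · have h0 : π'.char = π.char := by rw [← chi_toDual, ← chi_toDual, h]
    rw [h0]
    have hd : (π.dim : ℂ) ≠ 0 := Nat.cast_ne_zero.2 π.dim_pos.ne'
    simp only [char, Matrix.trace, Matrix.diag, map_sum, Finset.sum_mul_sum]
    rw [integral_finsetSum _ fun i _ => integrable_finsetSum _ fun j _ =>
      integrable_coeff_mul_conj π π i i j j]
    simp_rw [integral_finsetSum _ fun j _ => integrable_coeff_mul_conj π π _ _ j j,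
      integral_coeff_mul_conj]
    simp [hd]
  · have hne : ¬ π ≈ π' := fun h' => h ((toDual_eq_iff _ _).2 h')
    simp only [char, Matrix.trace, Matrix.diag, map_sum, Finset.sum_mul_sum]
    rw [integral_finsetSum _ fun i _ => integrable_finsetSum _ fun j _ =>
      integrable_coeff_mul_conj π π' i i j j]
    simp_rw [integral_finsetSum _ fun j _ => integrable_coeff_mul_conj π π' _ _ j j,
      integral_coeff_mul_conj_of_not_equiv hne]
    simp

end Irrep

end Orthogonality

/-! ### Translations and convolution operators on `L²(G)` -/

section Smoothing

variable {G : Type u} [Group G] [TopologicalSpace G] [IsTopologicalGroup G] [CompactSpace G]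
  [MeasurableSpace G] [BorelSpace G]

instance : (haarProb G).Regular := by unfold haarProb; infer_instance

/-- The embedding `C(G) → L²(G)`. -/
noncomputable def toL2 : C(G, ℂ) →L[ℂ] L2 G := ContinuousMap.toLp 2 (haarProb G) ℂ

theorem toL2_ae (φ : C(G, ℂ)) : toL2 φ =ᵐ[haarProb G] φ := ContinuousMap.coeFn_toLp _ _

theorem toL2_injective : Function.Injective (toL2 : C(G, ℂ) →L[ℂ] L2 G) :=
  ContinuousMap.toLp_injective (haarProb G)

theorem denseRange_toL2 : DenseRange (toL2 : C(G, ℂ) →L[ℂ] L2 G) :=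
  ContinuousMap.toLp_denseRange ℂ (haarProb G) ℂ (by simp)

/-- By density, identities between continuous maps on `L²(G)` need checking only on continuous
functions, where translations act pointwise and no null sets intervene. -/
theorem eq_of_eq_on_toL2 {X : Type*} [TopologicalSpace X] [T2Space X] {a b : L2 G → X}
    (ha : Continuous a) (hb : Continuous b) (h : ∀ φ, a (toL2 φ) = b (toL2 φ)) (f : L2 G) :
    a f = b f :=
  congrFun (denseRange_toL2.equalizer ha hb (funext h)) f

theorem inner_toL2 (φ ψ : C(G, ℂ)) :
    inner ℂ (toL2 φ) (toL2 ψ) = ∫ σ, ψ σ * conj (φ σ) ∂haarProb G :=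
  ContinuousMap.inner_toLp (haarProb G) φ ψ

/-- Left translation `(L_σ f)(τ) = f(σ⁻¹ τ)` on `L²(G)`. -/
noncomputable def leftTranslation (σ : G) : L2 G →ₗᵢ[ℂ] L2 G :=
  Lp.compMeasurePreservingₗᵢ ℂ (σ⁻¹ * ·) (measurePreserving_mul_left (haarProb G) σ⁻¹)

theorem continuous_leftTranslation (f : L2 G) :
    Continuous fun σ : G => leftTranslation σ f := by
  let g : G → C(G, G) :=
    (ContinuousMap.curry ⟨fun p : G × G => p.1⁻¹ * p.2, by fun_prop⟩ : C(G, C(G, G)))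
  have hg : Continuous g := ContinuousMap.continuous _
  exact Continuous.compMeasurePreservingLp (f := fun _ : G => f) continuous_const hg
    (fun σ => measurePreserving_mul_left (haarProb G) σ⁻¹) (by simp)

theorem continuous_conjTranslation (f : L2 G) :
    Continuous fun g : G => conjTranslation g f := by
  let c : G → C(G, G) :=
    (ContinuousMap.curry ⟨fun p : G × G => p.1 * p.2 * p.1⁻¹, by fun_prop⟩ : C(G, C(G, G)))
  have hc : Continuous c := ContinuousMap.continuous _
  exact Continuous.compMeasurePreservingLp (f := fun _ : G => f) continuous_const hc
    (fun g => measurePreserving_conj g) (by simp)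

theorem compMeasurePreserving_toL2 (c : C(G, G))
    (hc : MeasurePreserving c (haarProb G) (haarProb G))
    (φ : C(G, ℂ)) : Lp.compMeasurePreservingₗᵢ ℂ c hc (toL2 φ) = toL2 (φ.comp c) := by
  apply Lp.ext
  refine (Lp.coeFn_compMeasurePreserving _ hc).trans ?_
  exact (hc.quasiMeasurePreserving.ae_eq_comp (toL2_ae φ)).trans (toL2_ae (φ.comp c)).symm

theorem leftTranslation_toL2 (σ : G) (φ : C(G, ℂ)) :
    leftTranslation σ (toL2 φ) = toL2 (φ.comp ⟨(σ⁻¹ * ·), by fun_prop⟩) :=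
  compMeasurePreserving_toL2 ⟨(σ⁻¹ * ·), by fun_prop⟩ _ φ

theorem rightTranslation_toL2 (σ : G) (φ : C(G, ℂ)) :
    rightTranslation σ (toL2 φ) = toL2 (φ.comp ⟨(· * σ), by fun_prop⟩) :=
  compMeasurePreserving_toL2 ⟨(· * σ), by fun_prop⟩ _ φ

theorem conjTranslation_toL2 (g : G) (φ : C(G, ℂ)) :
    conjTranslation g (toL2 φ) = toL2 (φ.comp ⟨fun σ => g * σ * g⁻¹, by fun_prop⟩) :=
  compMeasurePreserving_toL2 ⟨fun σ => g * σ * g⁻¹, by fun_prop⟩ _ φ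

theorem leftTranslation_mul (σ τ : G) (f : L2 G) :
    leftTranslation (σ * τ) f = leftTranslation σ (leftTranslation τ f) := by
  refine eq_of_eq_on_toL2 (a := fun f => leftTranslation (σ * τ) f)
    (b := fun f => leftTranslation σ (leftTranslation τ f)) ?_ ?_ (fun φ => ?_) f
  · fun_prop
  · fun_prop
  simp only [leftTranslation_toL2]
  congr 1; ext x; simp [mul_assoc]

theorem leftTranslation_one (f : L2 G) : leftTranslation 1 f = f := by
  refine eq_of_eq_on_toL2 (a := fun f => leftTranslation 1 f)
    (b := fun f => f) ?_ ?_ (fun φ => ?_) f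
  · fun_prop
  · fun_prop
  simp only [leftTranslation_toL2]
  congr 1; ext x; simp

theorem rightTranslation_mul (σ τ : G) (f : L2 G) :
    rightTranslation (σ * τ) f = rightTranslation σ (rightTranslation τ f) := by
  refine eq_of_eq_on_toL2 (a := fun f => rightTranslation (σ * τ) f)
    (b := fun f => rightTranslation σ (rightTranslation τ f)) ?_ ?_ (fun φ => ?_) f
  · fun_prop
  · fun_prop
  simp only [rightTranslation_toL2]
  congr 1; ext x; simp [mul_assoc]

theorem rightTranslation_one (f : L2 G) : rightTranslation 1 f = f := by
  refine eq_of_eq_on_toL2 (a := fun f => rightTranslation 1 f)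
    (b := fun f => f) ?_ ?_ (fun φ => ?_) f
  · fun_prop
  · fun_prop
  simp only [rightTranslation_toL2]
  congr 1; ext x; simp

theorem conjTranslation_mul (g h : G) (f : L2 G) :
    conjTranslation (g * h) f = conjTranslation h (conjTranslation g f) := by
  refine eq_of_eq_on_toL2 (a := fun f => conjTranslation (g * h) f)
    (b := fun f => conjTranslation h (conjTranslation g f)) ?_ ?_ (fun φ => ?_) f
  · fun_prop
  · fun_prop
  simp only [conjTranslation_toL2]
  congr 1; ext x; simp [mul_assoc]

theorem conjTranslation_one (f : L2 G) : conjTranslation 1 f = f := by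
  refine eq_of_eq_on_toL2 (a := fun f => conjTranslation 1 f)
    (b := fun f => f) ?_ ?_ (fun φ => ?_) f
  · fun_prop
  · fun_prop
  simp only [conjTranslation_toL2]
  congr 1; ext x; simp

theorem leftTranslation_rightTranslation (σ τ : G) (f : L2 G) :
    leftTranslation σ (rightTranslation τ f) = rightTranslation τ (leftTranslation σ f) := by
  refine eq_of_eq_on_toL2 (a := fun f => leftTranslation σ (rightTranslation τ f))
    (b := fun f => rightTranslation τ (leftTranslation σ f)) ?_ ?_ (fun φ => ?_) f
  · fun_prop
  · fun_prop
  simp only [leftTranslation_toL2, rightTranslation_toL2]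
  congr 1; ext x; simp [mul_assoc]

theorem inner_leftTranslation_left (σ : G) (f g : L2 G) :
    inner ℂ (leftTranslation σ f) g = inner ℂ f (leftTranslation σ⁻¹ g) := by
  rw [← (leftTranslation σ).inner_map_map f, ← leftTranslation_mul, mul_inv_cancel,
    leftTranslation_one]

theorem inner_rightTranslation_left (σ : G) (f g : L2 G) :
    inner ℂ (rightTranslation σ f) g = inner ℂ f (rightTranslation σ⁻¹ g) := by
  rw [← (rightTranslation σ).inner_map_map f, ← rightTranslation_mul, mul_inv_cancel,
    rightTranslation_one]

theorem inner_conjTranslation_left (g : G) (f f' : L2 G) :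
    inner ℂ (conjTranslation g f) f' = inner ℂ f (conjTranslation g⁻¹ f') := by
  rw [← (conjTranslation g).inner_map_map f, ← conjTranslation_mul, inv_mul_cancel,
    conjTranslation_one]

/-! ### The Hunt operator commutes with translations and is symmetric -/

theorem hunt_leftTranslation (μ : Measure G) [IsProbabilityMeasure μ] (σ : G) (f : L2 G) :
    hunt μ (leftTranslation σ f) = leftTranslation σ (hunt μ f) := by
  rw [hunt_apply, hunt_apply]
  have h := (leftTranslation σ).toContinuousLinearMap.integral_comp_comm
    (integrable_rightTranslation μ f)
  simp only [LinearIsometry.coe_toContinuousLinearMap, leftTranslation_rightTranslation] at h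
  exact h

theorem hunt_conj_eq {μ : Measure G} [IsProbabilityMeasure μ] (h : IsCentral μ) (g : G)
    (f : L2 G) : ∫ τ, rightTranslation (g⁻¹ * τ * g) f ∂μ = hunt μ f := by
  have hm : AEMeasurable (fun x : G => g⁻¹ * x * g) μ := by fun_prop
  have hi := integrable_rightTranslation (μ.map (fun x : G => g⁻¹ * x * g)) f
  have h2 := integral_map hm hi.aestronglyMeasurable
  rw [← h2, h.map_conj g, hunt_apply]

theorem hunt_conjTranslation {μ : Measure G} [IsProbabilityMeasure μ] (h : IsCentral μ) (g : G)
    (f : L2 G) : hunt μ (conjTranslation g f) = conjTranslation g (hunt μ f) := by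
  have h1 := (conjTranslation g).toContinuousLinearMap.integral_comp_comm
    (integrable_rightTranslation μ f)
  simp only [LinearIsometry.coe_toContinuousLinearMap, conj_rightTranslation] at h1
  rw [hunt_conj_eq h] at h1
  rw [hunt_apply _ f, ← h1]

/-- Here `R_g R_τ = R_{gτg⁻¹} R_g`, and a central `μ` does not see the conjugation of `τ`. -/
theorem hunt_rightTranslation {μ : Measure G} [IsProbabilityMeasure μ] (h : IsCentral μ) (g : G)
    (f : L2 G) : hunt μ (rightTranslation g f) = rightTranslation g (hunt μ f) := by
  have h1 := (rightTranslation g).toContinuousLinearMap.integral_comp_comm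
    (integrable_rightTranslation μ f)
  simp only [LinearIsometry.coe_toContinuousLinearMap] at h1
  rw [hunt_apply _ f, ← h1, ← hunt_conj_eq h g⁻¹]
  simp only [← rightTranslation_mul]
  simp

omit [CompactSpace G] in
theorem IsSymmetric.map_inv {μ : Measure G} (h : IsSymmetric μ) :
    μ.map (fun x => x⁻¹) = μ := by
  ext A hA
  rw [Measure.map_apply measurable_inv hA, ← h A hA]
  congr 1
  exact (Set.image_inv_eq_inv (s := A)).symm

/-- The adjoint of `R_τ` is `R_{τ⁻¹}`, and `μ` is invariant under inversion. -/
theorem hunt_isSymmetric {μ : Measure G} [IsProbabilityMeasure μ] (h : IsSymmetric μ) :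
    (hunt μ : L2 G →ₗ[ℂ] L2 G).IsSymmetric := by
  intro f g
  change inner ℂ (hunt μ f) g = inner ℂ f (hunt μ g)
  have h1 : inner ℂ (hunt μ f) g = ∫ τ, inner ℂ (rightTranslation τ f) g ∂μ := by
    rw [← inner_conj_symm, hunt_apply, ← integral_inner (integrable_rightTranslation μ f),
      ← integral_conj]
    simp only [inner_conj_symm]
  have h2 : inner ℂ f (hunt μ g) = ∫ τ, inner ℂ f (rightTranslation τ g) ∂μ := by
    rw [hunt_apply, ← integral_inner (integrable_rightTranslation μ g)]
  have hc : Continuous fun τ : G => inner ℂ f (rightTranslation τ g) :=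
    continuous_const.inner (continuous_rightTranslation g)
  have h3 := integral_map (μ := μ) (φ := fun x : G => x⁻¹) measurable_inv.aemeasurable
    (integrable_of_continuous (μ.map fun x : G => x⁻¹) hc).aestronglyMeasurable
  rw [h.map_inv] at h3
  rw [h1, h2, h3]
  simp only [inner_rightTranslation_left]

theorem hunt_toL2_ae (μ : Measure G) [IsProbabilityMeasure μ] (φ : C(G, ℂ)) :
    hunt μ (toL2 φ) =ᵐ[haarProb G] fun σ => ∫ τ, φ (σ * τ) ∂μ :=
  hunt_continuousMap μ φ

/-! ### The operator with a square-integrable kernel -/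

/-- The function `σ ↦ ∫ conj κ(σ⁻¹τ) f(τ) dτ = ⟨L_σ κ, f⟩`. -/
noncomputable def smoothing (κ f : L2 G) : C(G, ℂ) :=
  ⟨fun σ => inner ℂ (leftTranslation σ κ) f, (continuous_leftTranslation κ).inner continuous_const⟩

@[simp] theorem smoothing_apply (κ f : L2 G) (σ : G) :
    smoothing κ f σ = inner ℂ (leftTranslation σ κ) f := rfl

theorem norm_smoothing_apply_le (κ f : L2 G) (σ : G) : ‖smoothing κ f σ‖ ≤ ‖κ‖ * ‖f‖ := by
  simpa using norm_inner_le_norm (𝕜 := ℂ) (leftTranslation σ κ) f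

/-- `smoothing` as a bounded operator from `L²(G)` to `C(G)`. -/
noncomputable def smoothingL (κ : L2 G) : L2 G →L[ℂ] C(G, ℂ) :=
  LinearMap.mkContinuous
    { toFun := smoothing κ
      map_add' := fun f g => by ext σ; simp [inner_add_right]
      map_smul' := fun c f => by ext σ; simp [inner_smul_right] }
    ‖κ‖ (fun f => (ContinuousMap.norm_le _ (by positivity)).2 (norm_smoothing_apply_le κ f))

theorem smoothingL_apply (κ f : L2 G) : smoothingL κ f = smoothing κ f := rfl

/-- The square-integrable density of a measure, as an element of `L²(G)`. -/
noncomputable def HasL2Density.density {μ : Measure G} (h : HasL2Density μ) : L2 G :=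
  (h.2.ofReal (K := ℂ)).toLp _

theorem HasL2Density.density_ae {μ : Measure G} (h : HasL2Density μ) :
    h.density =ᵐ[haarProb G] fun σ => ((μ.rnDeriv (haarProb G) σ).toReal : ℂ) :=
  (h.2.ofReal (K := ℂ)).coeFn_toLp

theorem HasL2Density.inner_density_toL2 {μ : Measure G} [IsFiniteMeasure μ] (h : HasL2Density μ)
    (φ : C(G, ℂ)) : inner ℂ h.density (toL2 φ) = ∫ σ, φ σ ∂μ := by
  rw [L2.inner_def, ← integral_rnDeriv_smul h.1]
  refine integral_congr_ae ?_
  filter_upwards [h.density_ae, toL2_ae φ] with σ h1 h2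
  rw [h1, h2]
  simp [mul_comm]

/-- This provides a continuous representative of every `T f`, so that identities in `L²(G)` can be
upgraded to pointwise ones. -/
theorem HasL2Density.toL2_smoothing {μ : Measure G} [IsProbabilityMeasure μ] (h : HasL2Density μ)
    (f : L2 G) : toL2 (smoothing h.density f) = hunt μ f := by
  refine eq_of_eq_on_toL2 (a := fun f => toL2 (smoothingL h.density f)) (by fun_prop)
    (by fun_prop) (fun φ => ?_) f
  apply Lp.ext
  refine (toL2_ae _).trans (EventuallyEq.trans ?_ (hunt_toL2_ae μ φ).symm)
  refine Eventually.of_forall fun σ => ?_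
  simp only [smoothingL_apply, smoothing_apply]
  rw [inner_leftTranslation_left, leftTranslation_toL2, h.inner_density_toL2]
  simp

/-- Arzelà–Ascoli: for `‖f‖ ≤ 1` the functions `⟨L_σ κ, f⟩` are bounded by `‖κ‖`, and they are
equicontinuous because their variation is at most `‖L_τ κ - L_σ κ‖`, which does not involve `f`. -/
theorem HasL2Density.isCompactOperator_hunt {μ : Measure G} [IsProbabilityMeasure μ]
    (h : HasL2Density μ) : IsCompactOperator (hunt μ : L2 G →L[ℂ] L2 G) := by
  set κ := h.density
  let A : Set (BoundedContinuousFunction G ℂ) :=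
    (fun f => BoundedContinuousFunction.mkOfCompact (smoothing κ f)) '' Metric.closedBall 0 1
  have hA : IsCompact (closure A) := by
    refine BoundedContinuousFunction.arzela_ascoli (Metric.closedBall 0 ‖κ‖)
      (isCompact_closedBall _ _) A ?_ ?_
    · rintro _ σ ⟨f, hf, rfl⟩
      rw [mem_closedBall_zero_iff] at hf ⊢
      refine (norm_smoothing_apply_le κ f σ).trans ?_
      exact mul_le_of_le_one_right (norm_nonneg _) hf
    · intro σ
      rw [Metric.equicontinuousAt_iff_right]
      intro ε hε
      filter_upwards [Metric.tendsto_nhds.1 ((continuous_leftTranslation κ).tendsto σ) ε hε]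
        with τ hτ
      rintro ⟨_, f, hf, rfl⟩
      rw [mem_closedBall_zero_iff] at hf
      rw [dist_comm, dist_eq_norm] at hτ ⊢
      change ‖inner ℂ (leftTranslation τ κ) f - inner ℂ (leftTranslation σ κ) f‖ < ε
      rw [← inner_sub_left, norm_sub_rev] at *
      refine lt_of_le_of_lt (norm_inner_le_norm _ _) (lt_of_le_of_lt ?_ hτ)
      exact mul_le_of_le_one_right (norm_nonneg _) hf
  refine (isCompactOperator_iff_image_closedBall_subset_compact
    (hunt μ : L2 G →ₗ[ℂ] L2 G) one_pos).2
    ⟨_, hA.image (BoundedContinuousFunction.toLp 2 (haarProb G) ℂ).continuous, ?_⟩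
  rintro _ ⟨f, hf, rfl⟩
  exact ⟨_, subset_closure ⟨f, hf, rfl⟩, h.toL2_smoothing f⟩

end Smoothing

/-! ### Matrix coefficients and completeness by compactness -/

section PeterWeyl

variable {G : Type u} [Group G] [TopologicalSpace G] [IsTopologicalGroup G] [CompactSpace G]
  [MeasurableSpace G] [BorelSpace G]

/-- A subspace of `L²(G)` stable under right translations. -/
def IsRightInvariant (V : Submodule ℂ (L2 G)) : Prop :=
  ∀ τ : G, ∀ v ∈ V, rightTranslation τ v ∈ V

/-- A minimal finite-dimensional right-invariant subspace is spanned by an orthonormal basis on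
which right translations act through an irreducible unitary matrix representation. -/
theorem IsRightInvariant.exists_irrep {V : Submodule ℂ (L2 G)} (hV : IsRightInvariant V)
    [FiniteDimensional ℂ V] (hV0 : V ≠ ⊥)
    (hmin : ∀ W ≤ V, IsRightInvariant W → W = ⊥ ∨ W = V) :
    ∃ (π : Irrep G) (e : Fin π.dim → L2 G), (∀ i, e i ∈ V) ∧ (∀ i, ‖e i‖ = 1) ∧
      ∀ τ i, rightTranslation τ (e i) = ∑ j, π.mat τ j i • e j := by
  let b := stdOrthonormalBasis ℂ V
  let e : Fin (Module.finrank ℂ V) → L2 G := fun i => b i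
  have heV : ∀ i, e i ∈ V := fun i => (b i).2
  have hexp : ∀ w ∈ V, w = ∑ k, inner ℂ (e k) w • e k := fun w hw => by
    have h := congrArg (Subtype.val) (b.sum_repr' ⟨w, hw⟩)
    simpa [e] using h.symm
  have horth : ∀ i j, inner ℂ (e i) (e j) = if i = j then (1 : ℂ) else 0 := fun i j =>
    orthonormal_iff_ite.1 b.orthonormal i j
  -- The second index is that of the translated vector, so that `R_τ e_i = ∑ j, M τ j i • e_j` and
  -- `M` is multiplicative rather than antimultiplicative.
  let M : G → Matrix (Fin (Module.finrank ℂ V)) (Fin (Module.finrank ℂ V)) ℂ := fun τ =>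
    Matrix.of fun j i => inner ℂ (e j) (rightTranslation τ (e i))
  have hRe : ∀ τ i, rightTranslation τ (e i) = ∑ j, M τ j i • e j := fun τ i =>
    hexp _ (hV τ _ (heV i))
  have hmul : ∀ σ τ, M (σ * τ) = M σ * M τ := fun σ τ => by
    ext j i
    rw [Matrix.mul_apply]
    change inner ℂ (e j) (rightTranslation (σ * τ) (e i)) = _
    rw [rightTranslation_mul, hRe τ i, map_sum, inner_sum]
    refine Finset.sum_congr rfl fun k _ => ?_
    rw [map_smul, inner_smul_right, mul_comm]
    rfl
  have hone : M 1 = 1 := by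
    ext j i
    rw [Matrix.one_apply, ← horth]
    change inner ℂ (e j) (rightTranslation 1 (e i)) = _
    rw [rightTranslation_one]
  have hstar : ∀ τ, star (M τ) = M τ⁻¹ := fun τ => by
    ext j i
    change conj (inner ℂ (e i) (rightTranslation τ (e j))) =
      inner ℂ (e j) (rightTranslation τ⁻¹ (e i))
    rw [inner_conj_symm, inner_rightTranslation_left]
  let ρ : G →* Matrix.unitaryGroup (Fin (Module.finrank ℂ V)) ℂ :=
    { toFun := fun τ => ⟨M τ, Matrix.mem_unitaryGroup_iff.2 (by
        rw [hstar, ← hmul, mul_inv_cancel, hone])⟩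
      map_one' := Subtype.ext hone
      map_mul' := fun σ τ => Subtype.ext (hmul σ τ) }
  have hρ : Continuous ρ := by
    refine Continuous.subtype_mk (continuous_matrix fun j i => ?_) _
    exact continuous_const.inner (continuous_rightTranslation (e i))
  -- `Φ` identifies `ℂⁿ` with `V` and intertwines `M` with right translation. It carries
  -- subrepresentations to right-invariant subspaces of `V`, so minimality of `V` becomes
  -- irreducibility.
  let Φ : (Fin (Module.finrank ℂ V) → ℂ) →ₗ[ℂ] L2 G := Fintype.linearCombination ℂ e
  have hΦ : ∀ x, Φ x = ∑ i, x i • e i := fun x => Fintype.linearCombination_apply ℂ e x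
  have hinner : ∀ x i, inner ℂ (e i) (Φ x) = x i := fun x i => by
    rw [hΦ, inner_sum]
    simp [inner_smul_right, horth]
  have hΦinj : Function.Injective Φ := fun x y hxy => funext fun i => by
    rw [← hinner x, ← hinner y, hxy]
  have hΦρ : ∀ τ x, Φ (unitaryRep ρ τ x) = rightTranslation τ (Φ x) := fun τ x => by
    change Φ ((M τ).mulVec x) = _
    simp only [hΦ, map_sum, map_smul, hRe, Matrix.mulVec, dotProduct, Finset.sum_smul,
      Finset.smul_sum, smul_smul]
    rw [Finset.sum_comm]
    exact Finset.sum_congr rfl fun _ _ => Finset.sum_congr rfl fun _ _ => by rw [mul_comm]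
  have hΦV : ∀ x, Φ x ∈ V := fun x => by
    rw [hΦ]; exact V.sum_mem fun i _ => V.smul_mem _ (heV i)
  have hΦsurj : ∀ w ∈ V, ∃ x, Φ x = w := fun w hw =>
    ⟨fun i => inner ℂ (e i) w, by rw [hΦ]; exact (hexp w hw).symm⟩
  have hirr : (unitaryRep ρ).IsIrreducible :=
    { exists_pair_ne := by
        obtain ⟨w, hw, hw0⟩ := V.ne_bot_iff.1 hV0
        obtain ⟨x, rfl⟩ := hΦsurj w hw
        refine ⟨⊥, ⊤, fun h => hw0 ?_⟩
        have hx : x ∈ (⊥ : Subrepresentation (unitaryRep ρ)) := by rw [h]; trivial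
        have hx0 : x = 0 := hx
        rw [hx0, map_zero]
      eq_bot_or_eq_top := fun S => by
        have hW : IsRightInvariant (S.toSubmodule.map Φ) := by
          rintro τ _ ⟨x, hx, rfl⟩
          exact ⟨_, S.apply_mem_toSubmodule τ hx, hΦρ τ x⟩
        rcases hmin _ (by rintro _ ⟨x, _, rfl⟩; exact hΦV x) hW with h | h
        · left
          apply Subrepresentation.toSubmodule_injective
          exact Submodule.map_injective_of_injective hΦinj (h.trans (Submodule.map_bot Φ).symm)
        · right
          apply Subrepresentation.toSubmodule_injective
          refine eq_top_iff.2 fun x _ => ?_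
          have hx : Φ x ∈ S.toSubmodule.map Φ := by rw [h]; exact hΦV x
          obtain ⟨y, hy, hyx⟩ := hx
          rwa [← hΦinj hyx] }
  refine ⟨⟨_, ρ, hρ, hirr⟩, e, heV, fun i => ?_, hRe⟩
  exact b.orthonormal.1 i

theorem rightTranslation_coeff (π : Irrep G) (i j : Fin π.dim) (τ : G) :
    rightTranslation τ (toL2 (π.coeff i j)) = ∑ k, π.mat τ k j • toL2 (π.coeff i k) := by
  rw [rightTranslation_toL2]
  simp only [← map_smul, ← map_sum]
  congr 1
  ext σ
  simp [ContinuousMap.sum_apply, Irrep.mat_mul_apply, mul_comm]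

theorem hunt_coeff (μ : Measure G) [IsProbabilityMeasure μ] (π : Irrep G) (i j : Fin π.dim) :
    hunt μ (toL2 (π.coeff i j)) = ∑ k, measureFourier μ π k j • toL2 (π.coeff i k) := by
  have h : ∀ k ∈ Finset.univ, Integrable
      (fun τ => π.mat τ k j • (toL2 (π.coeff i k) : L2 G)) μ := fun k _ =>
    (integrable_of_continuous μ (π.continuous_mat_apply k j)).smul_const _
  rw [hunt_apply]
  simp only [rightTranslation_coeff]
  rw [integral_finsetSum _ h]
  simp only [integral_smul_const]
  rfl

variable (G) in
/-- The elements of `L²(G)` orthogonal to all matrix coefficients of irreducible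
representations. -/
noncomputable def coeffOrthogonal : Submodule ℂ (L2 G) :=
  (Submodule.span ℂ {g | ∃ (π : Irrep G) (i j : Fin π.dim), toL2 (π.coeff i j) = g})ᗮ

theorem mem_coeffOrthogonal_iff (f : L2 G) : f ∈ coeffOrthogonal G ↔
    ∀ (π : Irrep G) (i j : Fin π.dim), inner ℂ (toL2 (π.coeff i j)) f = 0 := by
  constructor
  · intro h π i j
    exact (Submodule.mem_orthogonal _ _).1 h _ (Submodule.subset_span ⟨π, i, j, rfl⟩)
  · intro h
    refine (Submodule.mem_orthogonal _ _).2 fun u hu => ?_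
    induction hu using Submodule.span_induction with
    | mem x hx => obtain ⟨π, i, j, rfl⟩ := hx; exact h π i j
    | zero => simp
    | add x y _ _ hx hy => rw [inner_add_left, hx, hy, add_zero]
    | smul c x _ hx => rw [inner_smul_left, hx, mul_zero]

instance : CompleteSpace (coeffOrthogonal G) := by
  unfold coeffOrthogonal; infer_instance

theorem isRightInvariant_coeffOrthogonal : IsRightInvariant (coeffOrthogonal G) := by
  intro τ f hf
  rw [mem_coeffOrthogonal_iff] at hf ⊢
  intro π i j
  have h := inner_rightTranslation_left τ⁻¹ (toL2 (π.coeff i j)) f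
  rw [inv_inv] at h
  rw [← h, rightTranslation_coeff, sum_inner]
  simp [inner_smul_left, hf]

theorem hunt_mem_coeffOrthogonal {μ : Measure G} [IsProbabilityMeasure μ] (h : IsSymmetric μ)
    (f : L2 G) (hf : f ∈ coeffOrthogonal G) : hunt μ f ∈ coeffOrthogonal G := by
  rw [mem_coeffOrthogonal_iff] at hf ⊢
  intro π i j
  have h1 : inner ℂ (hunt μ (toL2 (π.coeff i j))) f = inner ℂ (toL2 (π.coeff i j)) (hunt μ f) :=
    hunt_isSymmetric h _ _
  rw [← h1, hunt_coeff, sum_inner]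
  simp [inner_smul_left, hf]

theorem exists_minimal_rightInvariant {F : Submodule ℂ (L2 G)} (hF : IsRightInvariant F)
    [FiniteDimensional ℂ F] (hF0 : F ≠ ⊥) :
    ∃ V ≤ F, IsRightInvariant V ∧ V ≠ ⊥ ∧
      ∀ W ≤ V, IsRightInvariant W → W = ⊥ ∨ W = V := by
  let s : Set (Submodule ℂ (L2 G)) := {V | V ≤ F ∧ IsRightInvariant V ∧ V ≠ ⊥}
  obtain ⟨V, ⟨hVF, hVi, hV0⟩, hmin⟩ := WellFounded.has_min
    (measure fun V : Submodule ℂ (L2 G) => Module.finrank ℂ V).wf s ⟨F, le_rfl, hF, hF0⟩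
  refine ⟨V, hVF, hVi, hV0, fun W hW hWi => or_iff_not_imp_left.2 fun hW0 => ?_⟩
  have : FiniteDimensional ℂ V := Submodule.finiteDimensional_of_le hVF
  exact Submodule.eq_of_le_of_finrank_le hW (not_lt.1 (hmin W ⟨hW.trans hVF, hWi, hW0⟩))

/-- `T` commutes with right translations; both sides of that identity have continuous
representatives, so it may be evaluated at the single point `1`. An eigenvector is thereby
determined by the values at `1` of its translates. -/
theorem HasL2Density.smoothing_apply_eq {μ : Measure G} [IsProbabilityMeasure μ]
    (h : HasL2Density μ) (hc : IsCentral μ) (f : L2 G) (σ : G) :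
    smoothing h.density f σ = smoothing h.density (rightTranslation σ f) 1 := by
  have h1 : smoothing h.density (rightTranslation σ f) =
      (smoothing h.density f).comp ⟨(· * σ), by fun_prop⟩ := by
    apply toL2_injective
    rw [h.toL2_smoothing, hunt_rightTranslation hc, ← h.toL2_smoothing, rightTranslation_toL2]
  rw [h1]
  simp

/-- The completeness statement of Peter–Weyl type for a convolution operator: the operator
vanishes on the orthogonal complement of the matrix coefficients. -/
theorem HasL2Density.hunt_eq_zero {μ : Measure G} [IsProbabilityMeasure μ]
    (h : HasL2Density μ) (hc : IsCentral μ) (hs : IsSymmetric μ) {f : L2 G}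
    (hf : f ∈ coeffOrthogonal G) : hunt μ f = 0 := by
  have hN := hunt_mem_coeffOrthogonal hs
  let S : coeffOrthogonal G →L[ℂ] coeffOrthogonal G := (hunt μ).restrict hN
  have hS_compact : IsCompactOperator S := h.isCompactOperator_hunt.restrict' hN
  have hS_symm : S.IsSymmetric := (hunt_isSymmetric hs).restrict_invariant hN
  -- A compact self-adjoint operator whose eigenvalues all vanish is zero.
  have hS : S = 0 := by
    rw [← ContinuousLinearMap.eq_zero_of_forall_hasEigenvalue_eq_zero hS_compact hS_symm]
    intro c hev
    by_contra hc0
    obtain ⟨v, hv⟩ := hev.exists_hasEigenvector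
    let F := Module.End.eigenspace (hunt μ : L2 G →ₗ[ℂ] L2 G) c ⊓ coeffOrthogonal G
    have hvF : (v : L2 G) ∈ F := by
      refine ⟨?_, v.2⟩
      rw [SetLike.mem_coe, Module.End.mem_eigenspace_iff]
      exact congrArg Subtype.val hv.apply_eq_smul
    have hF0 : F ≠ ⊥ := F.ne_bot_iff.2 ⟨v, hvF, fun h0 => hv.2 (Subtype.ext h0)⟩
    have : FiniteDimensional ℂ (Module.End.eigenspace (hunt μ : L2 G →ₗ[ℂ] L2 G) c) :=
      ContinuousLinearMap.finite_dimensional_eigenspace h.isCompactOperator_hunt c hc0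
    have : FiniteDimensional ℂ F := Submodule.finiteDimensional_of_le inf_le_left
    have hF : IsRightInvariant F := by
      rintro τ w ⟨hw1, hw2⟩
      refine ⟨?_, isRightInvariant_coeffOrthogonal τ w hw2⟩
      rw [SetLike.mem_coe, Module.End.mem_eigenspace_iff] at hw1 ⊢
      change hunt μ w = c • w at hw1
      change hunt μ _ = _
      rw [hunt_rightTranslation hc, hw1, map_smul]
    obtain ⟨V, hVF, hVi, hV0, hmin⟩ := exists_minimal_rightInvariant hF hF0
    have : FiniteDimensional ℂ V := Submodule.finiteDimensional_of_le hVF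
    obtain ⟨π, e, heV, he1, hRe⟩ := hVi.exists_irrep hV0 hmin
    let i : Fin π.dim := ⟨0, π.dim_pos⟩
    have hTe : toL2 (smoothing h.density (e i)) = c • e i := by
      rw [h.toL2_smoothing]
      exact Module.End.mem_eigenspace_iff.1 (hVF (heV i)).1
    -- Evaluating `T (R_σ e_i)` at `1` and expanding `R_σ e_i` in the `e_j` exhibits `T e_i = c e_i`
    -- as a combination of matrix coefficients. But `e_i` is orthogonal to all of those, which
    -- forces `c = 0`.
    have hsm : smoothing h.density (e i) =
        ∑ j, smoothing h.density (e j) 1 • π.coeff j i := by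
      ext σ
      rw [h.smoothing_apply_eq hc, hRe, ← smoothingL_apply, map_sum]
      simp [ContinuousMap.sum_apply, smoothingL_apply, mul_comm]
    have hzero : inner ℂ (c • e i) (e i) = 0 := by
      rw [← hTe, hsm, map_sum, sum_inner]
      refine Finset.sum_eq_zero fun j _ => ?_
      rw [map_smul, inner_smul_left,
        (mem_coeffOrthogonal_iff _).1 (hVF (heV i)).2 π j i, mul_zero]
    rw [inner_smul_left, inner_self_eq_norm_sq_to_K, he1] at hzero
    simp [hc0] at hzero
  exact congrArg Subtype.val (DFunLike.congr_fun hS (⟨f, hf⟩ : coeffOrthogonal G))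

end PeterWeyl

/-! ### Characters as an orthonormal family of class functions -/

section Characters

variable {G : Type u} [Group G] [TopologicalSpace G]

/-- The character of a class, as a continuous function. -/
def chiC (p : Dual G) : C(G, ℂ) :=
  ⟨chi p, by obtain ⟨π, rfl⟩ := exists_toDual_eq p; exact π.continuous_char⟩

@[simp] theorem chiC_apply (p : Dual G) (σ : G) : chiC p σ = chi p σ := rfl

theorem chiC_toDual (π : Irrep G) : chiC π.toDual = ∑ i, π.coeff i i := by
  ext σ
  simp [ContinuousMap.sum_apply, chi_toDual, Irrep.char, Matrix.trace]

theorem chi_conj (p : Dual G) (g σ : G) : chi p (g * σ * g⁻¹) = chi p σ := by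
  obtain ⟨π, rfl⟩ := exists_toDual_eq p
  rw [chi_toDual, Irrep.char, Irrep.mat_mul, Matrix.trace_mul_comm, ← Irrep.mat_mul]
  simp [Irrep.char]

theorem chi_inv (p : Dual G) (σ : G) : chi p σ⁻¹ = conj (chi p σ) := by
  obtain ⟨π, rfl⟩ := exists_toDual_eq p
  rw [chi_toDual, Irrep.char, Irrep.mat_inv, Matrix.trace_conjTranspose]
  rfl

/-- A character takes a positive integer value at `1`, which bounds it. -/
theorem exists_chi_one (p : Dual G) : ∃ d : ℕ, 0 < d ∧ chi p 1 = d ∧ ∀ σ, ‖chi p σ‖ ≤ d := by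
  obtain ⟨π, rfl⟩ := exists_toDual_eq p
  refine ⟨π.dim, π.dim_pos, π.char_one, fun σ => ?_⟩
  rw [chi_toDual, Irrep.char, Matrix.trace]
  refine (norm_sum_le _ _).trans ?_
  refine (Finset.sum_le_card_nsmul _ _ 1 fun i _ =>
    entry_norm_bound_of_unitary (π.hom σ).2 i i).trans ?_
  simp

variable [IsTopologicalGroup G] [CompactSpace G] [MeasurableSpace G] [BorelSpace G]

theorem inner_toL2_chiC [DecidableEq (Dual G)] (p q : Dual G) :
    inner ℂ (toL2 (chiC p)) (toL2 (chiC q)) = if p = q then (1 : ℂ) else 0 := by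
  obtain ⟨π, rfl⟩ := exists_toDual_eq p
  obtain ⟨π', rfl⟩ := exists_toDual_eq q
  rw [inner_toL2]
  simp only [chiC_apply, chi_toDual]
  rw [Irrep.integral_char_mul_conj]
  simp [eq_comm]

theorem toL2_chiC_mem (p : Dual G) : toL2 (chiC p) ∈ L2c G := by
  rw [mem_L2c_iff]
  intro g
  rw [conjTranslation_toL2]
  congr 1
  ext σ
  simp [chi_conj]

/-- The character of a class, as an element of `L²_c(G)`. -/
noncomputable def chiL2c (p : Dual G) : L2c G := ⟨toL2 (chiC p), toL2_chiC_mem p⟩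

theorem orthonormal_chiL2c : Orthonormal ℂ (chiL2c : Dual G → L2c G) := by
  classical
  exact orthonormal_iff_ite.2 fun p q => inner_toL2_chiC p q

theorem conjTranslation_coeff (π : Irrep G) (i j : Fin π.dim) (g : G) :
    conjTranslation g (toL2 (π.coeff i j)) =
      ∑ a, ∑ b, (π.mat g i a * conj (π.mat g j b)) • toL2 (π.coeff a b) := by
  rw [conjTranslation_toL2]
  simp only [← map_smul, ← map_sum]
  congr 1
  ext σ
  simp only [ContinuousMap.comp_apply, ContinuousMap.coe_mk, Irrep.coeff_apply,
    ContinuousMap.sum_apply, ContinuousMap.smul_apply, smul_eq_mul, Irrep.mat_mul_apply,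
    Irrep.mat_inv_apply, Finset.sum_mul]
  rw [Finset.sum_comm]
  exact Finset.sum_congr rfl fun _ _ => Finset.sum_congr rfl fun _ _ => by ring

/-- A central function orthogonal to all characters is orthogonal to all matrix coefficients. -/
theorem mem_coeffOrthogonal_of_mem_L2c {f : L2 G} (hf : f ∈ L2c G)
    (h : ∀ p : Dual G, inner ℂ (toL2 (chiC p)) f = 0) : f ∈ coeffOrthogonal G := by
  rw [mem_coeffOrthogonal_iff]
  intro π i j
  rw [mem_L2c_iff] at hf
  -- A central `f` pairs equally with a coefficient and with its conjugates. Averaging over `g` by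
  -- the orthogonality relations leaves `δ_ij / d` times `∑ a, ⟨π_aa, f⟩`, the pairing of `f` with
  -- the character.
  have h1 : ∀ g : G, inner ℂ (toL2 (π.coeff i j)) f =
      ∑ a, ∑ b, (π.mat g j b * conj (π.mat g i a)) * inner ℂ (toL2 (π.coeff a b)) f := fun g => by
    have h2 : inner ℂ (toL2 (π.coeff i j)) f =
        inner ℂ (conjTranslation g (toL2 (π.coeff i j))) f := by
      rw [inner_conjTranslation_left, hf]
    rw [h2, conjTranslation_coeff]
    simp only [sum_inner, inner_smul_left, map_mul, Complex.conj_conj]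
    exact Finset.sum_congr rfl fun _ _ => Finset.sum_congr rfl fun _ _ => by ring
  have hi := fun a b => (Irrep.integrable_coeff_mul_conj π π j b i a).mul_const
    (inner ℂ (toL2 (π.coeff a b)) f)
  have h3 : inner ℂ (toL2 (π.coeff i j)) f = ∫ _, inner ℂ (toL2 (π.coeff i j)) f ∂haarProb G := by
    simp
  rw [h3, integral_congr_ae (Eventually.of_forall h1),
    integral_finsetSum _ fun a _ => integrable_finsetSum _ fun b _ => hi a b]
  simp_rw [integral_finsetSum _ fun b _ => hi _ b, integral_mul_const,
    Irrep.integral_coeff_mul_conj]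
  by_cases hij : j = i
  · have h4 := h π.toDual
    rw [chiC_toDual, map_sum, sum_inner] at h4
    simp [hij, ← Finset.mul_sum, h4]
  · simp [hij]

end Characters

/-! ### Continuity at time zero, the Hilbert basis of characters, and exponents -/

section Semigroup

theorem measureFourier_apply {G : Type u} [Group G] [TopologicalSpace G] [MeasurableSpace G]
    (ν : Measure G) (π : Irrep G) (i j : Fin π.dim) :
    measureFourier ν π i j = ∫ σ, π.mat σ i j ∂ν := rfl

variable {G : Type u} [Group G] [TopologicalSpace G] [IsTopologicalGroup G] [CompactSpace G]
  [MeasurableSpace G] [BorelSpace G] {μ : ℝ≥0 → ProbabilityMeasure G}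

omit [IsTopologicalGroup G] in
theorem IsConvolutionSemigroup.continuous_integral (hμ : IsConvolutionSemigroup μ) (φ : C(G, ℝ)) :
    Continuous fun t => ∫ x, φ x ∂(μ t : Measure G) := by
  refine continuous_iff_continuousAt.2 fun t => ?_
  exact ProbabilityMeasure.tendsto_iff_forall_integral_tendsto.1 (hμ.continuous.tendsto t)
    (BoundedContinuousFunction.mkOfCompact φ)

/-- The semigroup law is given for real functions; matrix coefficients need it for complex ones, by
splitting into real and imaginary parts. -/
theorem IsConvolutionSemigroup.add_complex (hμ : IsConvolutionSemigroup μ) (s t : ℝ≥0)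
    (φ : C(G, ℂ)) : ∫ x, φ x ∂(μ (s + t) : Measure G) =
      ∫ x, ∫ y, φ (x * y) ∂(μ t : Measure G) ∂(μ s : Measure G) := by
  -- Integrating this family in the Banach space `C(G, ℂ)` shows at once that the inner integral is
  -- continuous in `x`.
  let F : C(G, C(G, ℂ)) := ContinuousMap.curry ⟨fun p : G × G => φ (p.2 * p.1), by fun_prop⟩
  have h1 : ∀ x, Integrable (fun y => φ (x * y)) (μ t : Measure G) := fun x =>
    integrable_of_continuous _ (by fun_prop)
  have hF : Integrable F (μ t : Measure G) := integrable_of_continuous _ F.continuous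
  have hc : Continuous fun x => ∫ y, φ (x * y) ∂(μ t : Measure G) := by
    refine (∫ y, F y ∂(μ t : Measure G)).continuous.congr fun x => ?_
    exact ((ContinuousMap.evalCLM ℂ x).integral_comp_comm hF).symm
  have h2 : Integrable (fun x => ∫ y, φ (x * y) ∂(μ t : Measure G)) (μ s : Measure G) :=
    integrable_of_continuous _ hc
  have h0 : Integrable φ (μ (s + t) : Measure G) := integrable_of_continuous _ φ.continuous
  apply Complex.ext
  · have := hμ.add s t ⟨fun x => (φ x).re, by fun_prop⟩
    have e1 : (∫ x, φ x ∂(μ (s + t) : Measure G)).re = ∫ x, (φ x).re ∂(μ (s + t) : Measure G) :=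
      (Complex.reCLM.integral_comp_comm h0).symm
    have e2 := (Complex.reCLM.integral_comp_comm h2).symm
    have e3 := fun x => (Complex.reCLM.integral_comp_comm (h1 x)).symm
    simp only [Complex.reCLM_apply] at e2 e3
    rw [e1, e2]
    simp only [e3]
    exact this
  · have := hμ.add s t ⟨fun x => (φ x).im, by fun_prop⟩
    have e1 : (∫ x, φ x ∂(μ (s + t) : Measure G)).im = ∫ x, (φ x).im ∂(μ (s + t) : Measure G) :=
      (Complex.imCLM.integral_comp_comm h0).symm
    have e2 := (Complex.imCLM.integral_comp_comm h2).symm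
    have e3 := fun x => (Complex.imCLM.integral_comp_comm (h1 x)).symm
    simp only [Complex.imCLM_apply] at e2 e3
    rw [e1, e2]
    simp only [e3]
    exact this

/-- The number `⟨f, T_t f⟩` is the `μ_t`-integral of the continuous function `τ ↦ ⟨f, R_τ f⟩`, so
its real part tends to the value at `τ = 1`, namely `‖f‖²`, as `t → 0`. -/
theorem IsConvolutionSemigroup.eq_zero_of_hunt_eq_zero (hμ : IsConvolutionSemigroup μ) {f : L2 G}
    (h : ∀ t, 0 < t → hunt (μ t : Measure G) f = 0) : f = 0 := by
  let u : C(G, ℝ) := ⟨fun τ => (inner ℂ f (rightTranslation τ f)).re,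
    Complex.continuous_re.comp (continuous_const.inner (continuous_rightTranslation f))⟩
  have hu : ∀ t, ∫ τ, u τ ∂(μ t : Measure G) = (inner ℂ f (hunt (μ t : Measure G) f)).re :=
    fun t => by
      rw [hunt_apply, ← integral_inner (integrable_rightTranslation _ f)]
      exact Complex.reCLM.integral_comp_comm ((integrable_of_continuous _
        (continuous_const.inner (continuous_rightTranslation f))))
  have h0 : ∫ τ, u τ ∂(μ 0 : Measure G) = 0 := by
    refine tendsto_nhds_unique (f := fun t => ∫ τ, u τ ∂(μ t : Measure G)) (l := 𝓝[>] 0)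
      ((hμ.continuous_integral u).continuousWithinAt) ?_
    refine Tendsto.congr' ?_ tendsto_const_nhds
    filter_upwards [self_mem_nhdsWithin] with t ht
    rw [hu, h t ht, inner_zero_right, Complex.zero_re]
  rw [hμ.zero, integral_dirac' _ _ u.continuous.stronglyMeasurable] at h0
  change (inner ℂ f (rightTranslation 1 f)).re = 0 at h0
  rw [rightTranslation_one, inner_self_eq_norm_sq_to_K] at h0
  rw [← RCLike.ofReal_pow] at h0
  exact norm_eq_zero.1 (pow_eq_zero_iff two_ne_zero |>.1 h0)

/-- The characters form a Hilbert basis of `L²_c(G)`. -/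
theorem IsConvolutionSemigroup.exists_hilbertBasis (hμ : IsConvolutionSemigroup μ)
    (hcentral : ∀ t, IsCentral (μ t : Measure G)) (hsymm : ∀ t, IsSymmetric (μ t : Measure G))
    (hL2 : ∀ t, 0 < t → HasL2Density (μ t : Measure G)) :
    ∃ b : HilbertBasis (Dual G) ℂ (L2c G), ∀ p, b p = chiL2c p := by
  refine ⟨HilbertBasis.mkOfOrthogonalEqBot orthonormal_chiL2c ?_,
    congrFun (HilbertBasis.coe_mkOfOrthogonalEqBot _ _)⟩
  refine (Submodule.eq_bot_iff _).2 fun f hf => Subtype.ext ?_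
  have h1 : (f : L2 G) ∈ coeffOrthogonal G := mem_coeffOrthogonal_of_mem_L2c f.2 fun p =>
    (Submodule.mem_orthogonal _ _).1 hf (chiL2c p) (Submodule.subset_span ⟨p, rfl⟩)
  exact hμ.eq_zero_of_hunt_eq_zero fun t ht =>
    (hL2 t ht).hunt_eq_zero (hcentral t) (hsymm t) h1

/-! ### Fourier transforms of central symmetric measures -/

/-- The scalar by which a central measure acts in the class `p`. -/
noncomputable def fourierScalar (ν : Measure G) (p : Dual G) : ℂ := (∫ σ, chi p σ ∂ν) / chi p 1

theorem IsCentral.mat_mul_measureFourier {ν : Measure G} [IsFiniteMeasure ν] (h : IsCentral ν)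
    (π : Irrep G) (τ : G) : π.mat τ * measureFourier ν π = measureFourier ν π * π.mat τ := by
  ext i j
  have h1 : (π.mat τ * measureFourier ν π) i j = ∫ σ, π.mat (τ * σ) i j ∂ν := by
    simp only [Matrix.mul_apply, measureFourier_apply, Irrep.mat_mul]
    rw [integral_finsetSum _ fun k _ =>
      (integrable_of_continuous ν (π.continuous_mat_apply k j)).const_mul _]
    simp_rw [integral_const_mul]
  have h2 : (measureFourier ν π * π.mat τ) i j = ∫ σ, π.mat (σ * τ) i j ∂ν := by
    simp only [Matrix.mul_apply, measureFourier_apply, Irrep.mat_mul]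
    rw [integral_finsetSum _ fun k _ =>
      (integrable_of_continuous ν (π.continuous_mat_apply i k)).mul_const _]
    simp_rw [integral_mul_const]
  have hm : AEMeasurable (fun x : G => τ⁻¹ * x * τ) ν := by fun_prop
  have hc : Continuous fun σ => π.mat (τ * σ) i j :=
    (π.continuous_mat_apply i j).comp (continuous_const_mul τ)
  have h3 := integral_map hm
    (integrable_of_continuous (ν.map fun x : G => τ⁻¹ * x * τ) hc).aestronglyMeasurable
  rw [h.map_conj] at h3
  rw [h1, h2, h3]
  simp [mul_assoc]

/-- Schur's lemma makes the Fourier transform scalar, and comparing traces identifies the scalar. -/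
theorem IsCentral.measureFourier_eq {ν : Measure G} [IsFiniteMeasure ν] (h : IsCentral ν)
    (π : Irrep G) : measureFourier ν π = fourierScalar ν π.toDual • 1 := by
  obtain ⟨c, hc⟩ := π.exists_eq_smul_one (h.mat_mul_measureFourier π)
  have hd : (π.dim : ℂ) ≠ 0 := Nat.cast_ne_zero.2 π.dim_pos.ne'
  have h1 : (measureFourier ν π).trace = ∫ σ, chi π.toDual σ ∂ν := by
    simp only [Matrix.trace, Matrix.diag, measureFourier_apply, chi_toDual, Irrep.char]
    rw [integral_finsetSum _ fun k _ => integrable_of_continuous ν (π.continuous_mat_apply k k)]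
  rw [fourierScalar, ← h1, chi_toDual, Irrep.char_one, hc]
  simp [hd]

theorem IsCentral.hunt_toL2_chiC {ν : Measure G} [IsProbabilityMeasure ν] (h : IsCentral ν)
    (p : Dual G) : hunt ν (toL2 (chiC p)) = fourierScalar ν p • toL2 (chiC p) := by
  obtain ⟨π, rfl⟩ := exists_toDual_eq p
  rw [chiC_toDual, map_sum, map_sum, Finset.smul_sum]
  refine Finset.sum_congr rfl fun i _ => ?_
  rw [hunt_coeff, h.measureFourier_eq]
  simp [Matrix.one_apply, ite_smul]

/-- Inversion conjugates a character and preserves `ν`, so the scalar is real. -/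
theorem IsSymmetric.conj_fourierScalar {ν : Measure G} [IsFiniteMeasure ν] (h : IsSymmetric ν)
    (p : Dual G) : conj (fourierScalar ν p) = fourierScalar ν p := by
  have h3 := integral_map (μ := ν) (φ := fun x : G => x⁻¹) measurable_inv.aemeasurable
    (integrable_of_continuous (ν.map fun x : G => x⁻¹) (chiC p).continuous).aestronglyMeasurable
  rw [h.map_inv] at h3
  simp only [chiC_apply, chi_inv] at h3
  obtain ⟨d, -, hd, -⟩ := exists_chi_one p
  rw [fourierScalar, map_div₀, ← integral_conj, ← h3, hd, Complex.conj_natCast]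

omit [IsTopologicalGroup G] [CompactSpace G] [BorelSpace G] in
theorem norm_fourierScalar_le (ν : Measure G) [IsProbabilityMeasure ν] (p : Dual G) :
    ‖fourierScalar ν p‖ ≤ 1 := by
  obtain ⟨d, hd0, hd, hle⟩ := exists_chi_one p
  have h := norm_integral_le_of_norm_le_const (μ := ν) (Eventually.of_forall hle)
  rw [fourierScalar, norm_div, hd, Complex.norm_natCast]
  exact div_le_one_of_le₀ (by simpa using h) (Nat.cast_nonneg _)

omit [IsTopologicalGroup G] [CompactSpace G] in
theorem IsConvolutionSemigroup.fourierScalar_zero (hμ : IsConvolutionSemigroup μ) (p : Dual G) :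
    fourierScalar (μ 0 : Measure G) p = 1 := by
  obtain ⟨d, hd0, hd, -⟩ := exists_chi_one p
  rw [fourierScalar, hμ.zero,
    integral_dirac' (chi p) _ (chiC p).continuous.stronglyMeasurable]
  exact div_self (by rw [hd]; exact Nat.cast_ne_zero.2 hd0.ne')

theorem IsConvolutionSemigroup.measureFourier_add (hμ : IsConvolutionSemigroup μ) (s t : ℝ≥0)
    (π : Irrep G) : measureFourier (μ (s + t) : Measure G) π =
      measureFourier (μ s : Measure G) π * measureFourier (μ t : Measure G) π := by
  ext i j
  have h := hμ.add_complex s t (π.coeff i j)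
  simp only [Irrep.coeff_apply, Irrep.mat_mul_apply] at h
  rw [measureFourier_apply, h, Matrix.mul_apply]
  simp_rw [integral_finsetSum _ fun k _ =>
      (integrable_of_continuous (μ t : Measure G) (π.continuous_mat_apply k j)).const_mul _,
    integral_const_mul]
  rw [integral_finsetSum _ fun k _ =>
      (integrable_of_continuous (μ s : Measure G) (π.continuous_mat_apply i k)).mul_const _]
  simp_rw [integral_mul_const]
  rfl

theorem IsConvolutionSemigroup.fourierScalar_add (hμ : IsConvolutionSemigroup μ)
    (hcentral : ∀ t, IsCentral (μ t : Measure G)) (s t : ℝ≥0) (p : Dual G) :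
    fourierScalar (μ (s + t) : Measure G) p =
      fourierScalar (μ s : Measure G) p * fourierScalar (μ t : Measure G) p := by
  obtain ⟨π, rfl⟩ := exists_toDual_eq p
  have h := hμ.measureFourier_add s t π
  rw [(hcentral _).measureFourier_eq, (hcentral s).measureFourier_eq,
    (hcentral t).measureFourier_eq] at h
  have h1 := congrFun (congrFun h ⟨0, π.dim_pos⟩) ⟨0, π.dim_pos⟩
  simpa [mul_comm] using h1

omit [IsTopologicalGroup G] in
theorem IsConvolutionSemigroup.continuous_fourierScalar_re (hμ : IsConvolutionSemigroup μ)
    (p : Dual G) : Continuous fun t => (fourierScalar (μ t : Measure G) p).re := by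
  obtain ⟨d, -, hd, -⟩ := exists_chi_one p
  have h := (hμ.continuous_integral ⟨fun σ => (chiC p σ).re, by fun_prop⟩).div_const (d : ℝ)
  refine h.congr fun t => ?_
  rw [fourierScalar, hd, Complex.div_natCast_re]
  congr 1
  exact Complex.reCLM.integral_comp_comm (integrable_of_continuous _ (chiC p).continuous)

/-- A continuous multiplicative function on `ℝ≥0` with values in `[-1, 1]` and `c 0 = 1` is
`t ↦ exp (t α)` with `α ≤ 0`. -/
theorem exists_eq_exp_of_mul {c : ℝ≥0 → ℝ} (hc : Continuous c) (h0 : c 0 = 1)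
    (hadd : ∀ s t, c (s + t) = c s * c t) (hle : ∀ t, |c t| ≤ 1) :
    ∃ α ≤ 0, ∀ t : ℝ≥0, c t = Real.exp (t * α) := by
  have hsq : ∀ t, c t = c (t / 2) * c (t / 2) := fun t => by rw [← hadd, add_halves]
  -- A zero at `t` would propagate to `t / 2 ^ n` for all `n`, contradicting continuity at `0` and
  -- `c 0 = 1`.
  have hne : ∀ t, c t ≠ 0 := fun t ht => by
    have h1 : ∀ n : ℕ, c (t / 2 ^ n) = 0 := fun n => by
      induction n with
      | zero => simpa using ht
      | succ n ih =>
        rw [hsq, div_div, ← pow_succ] at ih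
        exact mul_self_eq_zero.1 ih
    have h2 : Tendsto (fun n : ℕ => t / 2 ^ n) atTop (𝓝 0) := by
      have h3 := (NNReal.tendsto_pow_atTop_nhds_zero_of_lt_one (r := (2⁻¹ : ℝ≥0))
        (NNReal.coe_lt_coe.1 (by push_cast; norm_num))).const_mul t
      simpa [div_eq_mul_inv] using h3
    have h3 := (hc.tendsto 0).comp h2
    simp only [Function.comp_def, h1, h0] at h3
    exact zero_ne_one (tendsto_nhds_unique tendsto_const_nhds h3)
  have hpos : ∀ t, 0 < c t := fun t => lt_of_le_of_ne (by rw [hsq]; exact mul_self_nonneg _)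
    (hne t).symm
  let g : ℝ≥0 →+ ℝ :=
    { toFun := fun t => Real.log (c t)
      map_zero' := by simp [h0]
      map_add' := fun s t => by rw [hadd, Real.log_mul (hne s) (hne t)] }
  have hg : Continuous g := hc.log hne
  -- Extends `log ∘ c` from the half-line to an additive map on `ℝ` through positive and negative
  -- parts; continuity then makes it real-linear.
  let L : ℝ →+ ℝ := AddMonoidHom.mk' (fun x => g x.toNNReal - g (-x).toNNReal) fun x y => by
    have h1 : (x + y).toNNReal + ((-x).toNNReal + (-y).toNNReal) =
        (-(x + y)).toNNReal + (x.toNNReal + y.toNNReal) := by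
      apply NNReal.eq
      push_cast
      simp only [Real.coe_toNNReal']
      have h2 : ∀ z : ℝ, max z 0 - max (-z) 0 = z := fun z => by
        rcases le_total 0 z with hz | hz
        · rw [max_eq_left hz, max_eq_right (by linarith)]; ring
        · rw [max_eq_right hz, max_eq_left (by linarith)]; ring
      linarith [h2 x, h2 y, h2 (x + y)]
    have h3 := congrArg g h1
    simp only [map_add] at h3
    linarith
  have hL : Continuous L := by
    change Continuous fun x : ℝ => g x.toNNReal - g (-x).toNNReal
    fun_prop
  have hLg : ∀ t : ℝ≥0, L t = g t := fun t => by
    change g (t : ℝ).toNNReal - g (-(t : ℝ)).toNNReal = g t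
    simp [Real.toNNReal_of_nonpos]
  have hlin : ∀ t : ℝ≥0, g t = t * L 1 := fun t => by
    have h1 := (L.toRealLinearMap hL).map_smul (t : ℝ) 1
    simp only [smul_eq_mul, mul_one] at h1
    rw [← hLg]
    exact h1
  refine ⟨L 1, ?_, fun t => ?_⟩
  · have h1 := hLg 1
    rw [NNReal.coe_one] at h1
    rw [h1]
    exact Real.log_nonpos (hpos 1).le ((le_abs_self _).trans (hle 1))
  · rw [← hlin]
    exact (Real.exp_log (hpos t)).symm

theorem IsConvolutionSemigroup.exists_exponent (hμ : IsConvolutionSemigroup μ)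
    (hcentral : ∀ t, IsCentral (μ t : Measure G)) (hsymm : ∀ t, IsSymmetric (μ t : Measure G)) :
    ∃ α : Dual G → ℝ, (∀ p, α p ≤ 0) ∧
      ∀ (t : ℝ≥0) p, fourierScalar (μ t : Measure G) p = (Real.exp (t * α p) : ℂ) := by
  have hre : ∀ t p, (((fourierScalar (μ t : Measure G) p).re : ℝ) : ℂ) =
      fourierScalar (μ t : Measure G) p := fun t p =>
    Complex.conj_eq_iff_re.1 ((hsymm t).conj_fourierScalar p)
  have h : ∀ p : Dual G, ∃ α ≤ 0, ∀ t : ℝ≥0,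
      (fourierScalar (μ t : Measure G) p).re = Real.exp (t * α) := fun p => by
    refine exists_eq_exp_of_mul (hμ.continuous_fourierScalar_re p) ?_ (fun s t => ?_) fun t => ?_
    · rw [hμ.fourierScalar_zero, Complex.one_re]
    · rw [hμ.fourierScalar_add hcentral, ← hre s, ← hre t]
      norm_cast
    · exact (Complex.abs_re_le_norm _).trans (norm_fourierScalar_le _ p)
  choose α hα0 hα using h
  exact ⟨α, hα0, fun t p => by rw [← hre, hα]⟩

end Semigroup

/-! ### Trace of a diagonal operator in an arbitrary orthonormal basis -/

section DiagonalTrace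

variable {H : Type u} [NormedAddCommGroup H] [InnerProductSpace ℂ H] {ι : Type*}

/-- A diagonal operator with summable nonnegative eigenvalues is of trace class, and its trace is
the sum of the eigenvalues. -/
theorem hasTrace_of_hilbertBasis [Countable ι] (b : HilbertBasis ι ℂ H) {T : H →L[ℂ] H}
    {c : ι → ℝ} (hc : ∀ i, 0 ≤ c i) (hT : ∀ i, T (b i) = (c i : ℂ) • b i) {s : ℝ}
    (hs : HasSum c s) : HasTrace T (s : ℂ) := by
  have hTx : ∀ x, HasSum (fun i => inner ℂ (b i) x • ((c i : ℂ) • b i)) (T x) := fun x => by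
    have h := (b.hasSum_repr x).mapL T
    simpa only [map_smul, hT, b.repr_apply_apply] using h
  refine ⟨?_, fun w e => ?_⟩
  -- The nuclear decomposition must be indexed by `ℕ`: the eigenvector expansion is transported
  -- along an injection of `ι` and extended by zero.
  · have := Encodable.ofCountable ι
    have hinj := Encodable.encode_injective (α := ι)
    refine ⟨Function.extend Encodable.encode (fun i => (c i : ℂ) • b i) 0,
      Function.extend Encodable.encode b 0, ?_, fun x => ?_⟩
    · refine (hinj.summable_iff fun n hn => ?_).1 ?_
      · rw [Function.extend_apply' _ _ _ hn]; simp
      · refine hs.summable.congr fun i => ?_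
        simp only [Function.comp_apply, hinj.extend_apply, norm_smul, b.orthonormal.1 i,
          Complex.norm_real, Real.norm_of_nonneg (hc i), mul_one]
    · refine (hinj.hasSum_iff fun n hn => ?_).1 ?_
      · rw [Function.extend_apply' _ _ _ hn]; simp
      · simpa only [Function.comp_def, hinj.extend_apply] using hTx x
  -- Parseval in the second index gives the eigenvalue `c i`; summing in the first gives the
  -- diagonal entry `⟨e k, T (e k)⟩`. Nonnegativity allows the order of summation to be exchanged.
  · let u : ι × w → ℝ := fun q => c q.1 * ‖inner ℂ (b q.1) (e q.2)‖ ^ 2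
    have hu0 : 0 ≤ u := fun q => mul_nonneg (hc _) (sq_nonneg _)
    have hsq : ∀ x y : H, inner ℂ x y * inner ℂ y x = ((‖inner ℂ x y‖ ^ 2 : ℝ) : ℂ) :=
      fun x y => by
        rw [← inner_conj_symm y x, Complex.mul_conj, Complex.normSq_eq_norm_sq]
    have hcol : ∀ i, HasSum (fun k => u (i, k)) (c i) := fun i => by
      have h := e.hasSum_inner_mul_inner (b i) (b i)
      simp only [hsq, inner_self_eq_norm_sq_to_K, b.orthonormal.1 i] at h
      have h1 : HasSum (fun k => ‖inner ℂ (b i) (e k)‖ ^ 2) 1 := by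
        rw [← Complex.hasSum_ofReal]
        simpa using h
      simpa using h1.mul_left (c i)
    have hrow : ∀ k, HasSum (fun i => ((u (i, k) : ℝ) : ℂ)) (inner ℂ (e k) (T (e k))) :=
      fun k => by
        have h := (hTx (e k)).mapL (innerSL ℂ (e k))
        refine h.congr_fun fun i => ?_
        simp only [innerSL_apply_apply, inner_smul_right, u]
        push_cast
        rw [← Complex.ofReal_pow, ← hsq]
        ring
    have hsum : Summable u := (summable_prod_of_nonneg hu0).2
      ⟨fun i => (hcol i).summable, hs.summable.congr fun i => ((hcol i).tsum_eq).symm⟩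
    have hS : HasSum u s := by
      have h := hsum.hasSum.prod_fiberwise hcol
      rw [hs.unique h]
      exact hsum.hasSum
    have hS' : HasSum (fun q : w × ι => ((u q.swap : ℝ) : ℂ)) (s : ℂ) :=
      ((Equiv.prodComm w ι).hasSum_iff (f := fun q => ((u q : ℝ) : ℂ))).2
        (Complex.hasSum_ofReal.2 hS)
    exact hS'.prod_fiberwise hrow

end DiagonalTrace

/-! ### Averaging over conjugations -/

section CentralProjection

variable {G : Type u} [Group G] [TopologicalSpace G] [IsTopologicalGroup G] [CompactSpace G]
  [MeasurableSpace G] [BorelSpace G]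

theorem integrable_conjTranslation (f : L2 G) :
    Integrable (fun g : G => conjTranslation g f) (haarProb G) :=
  integrable_of_continuous _ (continuous_conjTranslation f)

theorem integral_conjTranslation_mem (f : L2 G) :
    ∫ g, conjTranslation g f ∂haarProb G ∈ L2c G := by
  rw [mem_L2c_iff]
  intro h
  have h1 := (conjTranslation h).toContinuousLinearMap.integral_comp_comm
    (integrable_conjTranslation f)
  simp only [LinearIsometry.coe_toContinuousLinearMap, ← conjTranslation_mul] at h1
  rw [← h1]
  exact integral_mul_right_eq_self (fun g => conjTranslation g f) h

/-- The orthogonal projection of `L²(G)` onto `L²_c(G)`: the average over conjugations. -/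
noncomputable def centralPart (f : L2 G) : L2c G :=
  ⟨∫ g, conjTranslation g f ∂haarProb G, integral_conjTranslation_mem f⟩

/-- Each conjugation is isometric and fixes the class function `u`, so averaging does not change the
pairing. -/
theorem inner_centralPart (u : L2c G) (f : L2 G) :
    inner ℂ u (centralPart f) = inner ℂ (u : L2 G) f := by
  have hu := (mem_L2c_iff _).1 u.2
  change inner ℂ (u : L2 G) (∫ g, conjTranslation g f ∂haarProb G) = _
  rw [← integral_inner (integrable_conjTranslation f)]
  have h : ∀ g, inner ℂ (u : L2 G) (conjTranslation g f) = inner ℂ (u : L2 G) f := fun g => by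
    have := (conjTranslation g).inner_map_map (u : L2 G) f
    rwa [hu] at this
  simp [h]

end CentralProjection

/-! ### Continuous densities, the character expansion and the trace -/

section Density

variable {G : Type u} [TopologicalSpace G]

/-- A real continuous function, regarded as complex-valued. -/
def ofRealC (k : C(G, ℝ)) : C(G, ℂ) := ⟨fun σ => (k σ : ℂ), by fun_prop⟩

@[simp] theorem ofRealC_apply (k : C(G, ℝ)) (σ : G) : ofRealC k σ = (k σ : ℂ) := rfl

variable [Group G] [IsTopologicalGroup G] [CompactSpace G] [MeasurableSpace G] [BorelSpace G]

theorem HasL2Density.toL2_ofRealC {ν : Measure G} (h : HasL2Density ν) {k : C(G, ℝ)}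
    (hk : IsDensity ν k) : toL2 (ofRealC k) = h.density := by
  apply Lp.ext
  filter_upwards [toL2_ae (ofRealC k), h.density_ae, hk.2] with σ h1 h2 h3
  rw [h1, h2, ofRealC_apply, h3]

theorem HasL2Density.smoothing_toL2 {ν : Measure G} [IsFiniteMeasure ν] (h : HasL2Density ν)
    (φ : C(G, ℂ)) (σ : G) : smoothing h.density (toL2 φ) σ = ∫ τ, φ (σ * τ) ∂ν := by
  rw [smoothing_apply, inner_leftTranslation_left, leftTranslation_toL2, h.inner_density_toL2]
  simp

theorem HasL2Density.smoothing_leftTranslation {ν : Measure G} [IsProbabilityMeasure ν]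
    (h : HasL2Density ν) (ρ : G) (f : L2 G) (σ : G) :
    smoothing h.density (leftTranslation ρ f) σ = smoothing h.density f (ρ⁻¹ * σ) := by
  have h1 : smoothing h.density (leftTranslation ρ f) =
      (smoothing h.density f).comp ⟨(ρ⁻¹ * ·), by fun_prop⟩ := by
    apply toL2_injective
    rw [h.toL2_smoothing, hunt_leftTranslation, ← h.toL2_smoothing, leftTranslation_toL2]
  rw [h1]; rfl

theorem HasL2Density.smoothing_conjTranslation {ν : Measure G} [IsProbabilityMeasure ν]
    (h : HasL2Density ν) (hc : IsCentral ν) (g : G) (f : L2 G) (σ : G) :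
    smoothing h.density (conjTranslation g f) σ = smoothing h.density f (g * σ * g⁻¹) := by
  have h1 : smoothing h.density (conjTranslation g f) =
      (smoothing h.density f).comp ⟨fun σ => g * σ * g⁻¹, by fun_prop⟩ := by
    apply toL2_injective
    rw [h.toL2_smoothing, hunt_conjTranslation hc, ← h.toL2_smoothing, conjTranslation_toL2]
  rw [h1]; rfl

theorem HasL2Density.smoothing_chiC {ν : Measure G} [IsProbabilityMeasure ν]
    (h : HasL2Density ν) (hc : IsCentral ν) (p : Dual G) (σ : G) :
    smoothing h.density (toL2 (chiC p)) σ = fourierScalar ν p * chi p σ := by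
  have h1 : smoothing h.density (toL2 (chiC p)) = fourierScalar ν p • chiC p := by
    apply toL2_injective
    rw [h.toL2_smoothing, hc.hunt_toL2_chiC, map_smul]
  rw [h1]; rfl

variable {μ : ℝ≥0 → ProbabilityMeasure G}

/-- The density of `μ_{s+s}` is the convolution square of the density of `μ_s`. -/
theorem IsConvolutionSemigroup.toL2_smoothing_density (hμ : IsConvolutionSemigroup μ) {s : ℝ≥0}
    (hsymm : IsSymmetric (μ s : Measure G)) (h : HasL2Density (μ s : Measure G))
    (h2 : HasL2Density (μ (s + s) : Measure G)) :
    toL2 (smoothing h.density h.density) = h2.density := by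
  refine ext_inner_right ℂ fun f => ?_
  refine eq_of_eq_on_toL2 (a := fun f => inner ℂ (toL2 (smoothing h.density h.density)) f)
    (b := fun f => inner ℂ h2.density f) (by fun_prop) (by fun_prop) (fun φ => ?_) f
  have h3 : inner ℂ (hunt (μ s : Measure G) h.density) (toL2 φ) =
    inner ℂ h.density (hunt (μ s : Measure G) (toL2 φ)) := hunt_isSymmetric hsymm _ _
  rw [h.toL2_smoothing, h3, ← h.toL2_smoothing (toL2 φ), h.inner_density_toL2,
    h2.inner_density_toL2, hμ.add_complex]
  simp only [h.smoothing_toL2]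

/-- Existence comes from the convolution square `⟨L_σ κ, κ⟩`, continuous because translation is
continuous in `L²(G)`. Uniqueness holds since continuous functions equal almost everywhere for Haar
measure coincide. -/
theorem IsConvolutionSemigroup.existsUnique_density (hμ : IsConvolutionSemigroup μ) {s : ℝ≥0}
    (hsymm : IsSymmetric (μ s : Measure G)) (h : HasL2Density (μ s : Measure G))
    (h2 : HasL2Density (μ (s + s) : Measure G)) :
    ∃! k : C(G, ℝ), IsDensity (μ (s + s) : Measure G) k := by
  have hK := hμ.toL2_smoothing_density hsymm h h2
  refine ⟨⟨fun σ => (smoothing h.density h.density σ).re, by fun_prop⟩, ⟨h2.1, ?_⟩,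
    fun k' hk' => ?_⟩
  · have h3 := toL2_ae (smoothing h.density h.density)
    rw [hK] at h3
    filter_upwards [h3, h2.density_ae] with σ h4 h5
    rw [ContinuousMap.coe_mk, ← h4, h5, Complex.ofReal_re]
  · have h3 : ofRealC k' = smoothing h.density h.density := by
      apply toL2_injective
      rw [hK, h2.toL2_ofRealC hk']
    ext σ
    change k' σ = (smoothing h.density h.density σ).re
    rw [← h3, ofRealC_apply, Complex.ofReal_re]

/-- The character expansion of the conjugation-averaged density. -/
theorem IsConvolutionSemigroup.hasSum_integral_density (hμ : IsConvolutionSemigroup μ)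
    {s : ℝ≥0} (hcentral : IsCentral (μ s : Measure G)) (hsymm : IsSymmetric (μ s : Measure G))
    (h : HasL2Density (μ s : Measure G)) (h2 : HasL2Density (μ (s + s) : Measure G))
    (b : HilbertBasis (Dual G) ℂ (L2c G)) (hb : ∀ p, b p = chiL2c p)
    {k : C(G, ℝ)} (hk : IsDensity (μ (s + s) : Measure G) k) (σ ρ : G) :
    HasSum (fun p : Dual G => fourierScalar (μ s : Measure G) p ^ 2 * conj (chi p σ) * chi p ρ)
      ((∫ g, k (σ⁻¹ * (g * ρ * g⁻¹)) ∂haarProb G : ℝ) : ℂ) := by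
  have hkK : ofRealC k = smoothing h.density h.density := by
    apply toL2_injective
    rw [hμ.toL2_smoothing_density hsymm h h2, h2.toL2_ofRealC hk]
  -- Parseval is applied to `⟨F ρ, F σ⟩`. Each coefficient against a character carries one Fourier
  -- scalar of `μ s`, so the products carry its square, the scalar of `μ (s + s)`.
  let F : G → L2c G := fun x => centralPart (leftTranslation x h.density)
  have hcoef : ∀ p x, inner ℂ (F x) (b p) = fourierScalar (μ s : Measure G) p * chi p x :=
    fun p x => by
      rw [hb, ← h.smoothing_chiC hcentral, smoothing_apply, ← inner_conj_symm]
      refine (inner_conj_symm (F x) (chiL2c p)).symm.trans ?_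
      rw [inner_centralPart]
      rfl
  have hcoef' : ∀ p x, inner ℂ (b p) (F x) =
      fourierScalar (μ s : Measure G) p * conj (chi p x) := fun p x => by
    refine (inner_conj_symm (b p) (F x)).symm.trans ?_
    rw [hcoef, map_mul, hsymm.conj_fourierScalar]
  have hval : inner ℂ (F ρ) (F σ) =
      ((∫ g, k (σ⁻¹ * (g * ρ * g⁻¹)) ∂haarProb G : ℝ) : ℂ) := by
    have h3 : inner ℂ (F σ) (F ρ) =
        ((∫ g, k (σ⁻¹ * (g * ρ * g⁻¹)) ∂haarProb G : ℝ) : ℂ) := by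
      -- Projecting only one of the two vectors suffices. The pairing is `T` applied to a conjugated
      -- translate and evaluated at `ρ`; moving both operations out of `T` leaves `T κ`, that is
      -- `k`, at `σ⁻¹ g ρ g⁻¹`.
      have h4 : ∀ g, inner ℂ (leftTranslation ρ h.density)
          (conjTranslation g (leftTranslation σ h.density)) =
            ((k (σ⁻¹ * (g * ρ * g⁻¹)) : ℝ) : ℂ) := fun g => by
        rw [← smoothing_apply, h.smoothing_conjTranslation hcentral, h.smoothing_leftTranslation,
          ← hkK, ofRealC_apply]
      rw [inner_centralPart, ← inner_conj_symm]
      change conj (inner ℂ (leftTranslation ρ h.density)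
        (∫ g, conjTranslation g (leftTranslation σ h.density) ∂haarProb G)) = _
      rw [← integral_inner (integrable_conjTranslation _)]
      simp only [h4]
      rw [integral_complex_ofReal, Complex.conj_ofReal]
    refine (inner_conj_symm (F ρ) (F σ)).symm.trans ?_
    rw [h3, Complex.conj_ofReal]
  rw [← hval]
  refine (b.hasSum_inner_mul_inner (F ρ) (F σ)).congr_fun fun p => ?_
  rw [hcoef, hcoef']
  ring

/-- If the characters are eigenvectors of `T` and the averaged density has the character expansion,
then the trace of `T` on `L²_c(G)` is the integral of the expansion along the diagonal. -/
theorem hasTrace_huntCentral {ν : Measure G} [IsProbabilityMeasure ν] (hν : IsCentral ν)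
    (b : HilbertBasis (Dual G) ℂ (L2c G)) (hb : ∀ p, b p = chiL2c p) {c : Dual G → ℝ}
    (hc : ∀ p, 0 < c p) (hνc : ∀ p, fourierScalar ν p = (c p : ℂ)) {F : G → ℝ}
    (hF : ∀ σ, HasSum (fun p => (c p : ℂ) * conj (chi p σ) * chi p σ) (F σ : ℂ)) :
    HasTrace (huntCentral ν hν) ((∫ σ, F σ ∂haarProb G : ℝ) : ℂ) := by
  classical
  have hFr : ∀ σ, HasSum (fun p => c p * ‖chi p σ‖ ^ 2) (F σ) := fun σ => by
    rw [← Complex.hasSum_ofReal]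
    refine (hF σ).congr_fun fun p => ?_
    rw [mul_assoc, mul_comm (conj _), Complex.mul_conj, Complex.normSq_eq_norm_sq]
    push_cast
    rfl
  have hpos : ∀ p, 0 < c p * ‖chi p (1 : G)‖ ^ 2 := fun p => by
    obtain ⟨d, hd0, hd, -⟩ := exists_chi_one p
    rw [hd, Complex.norm_natCast]
    have := hc p
    positivity
  -- At `1` the expansion is a convergent sum of strictly positive terms, so its index set is
  -- countable.
  have : Countable (Dual G) := by
    have h := (hFr 1).summable.countable_support
    have huniv : (Function.support fun p => c p * ‖chi p (1 : G)‖ ^ 2) = Set.univ :=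
      Set.eq_univ_of_forall fun p => (hpos p).ne'
    rw [huniv] at h
    exact Set.countable_univ_iff.1 h
  have hint : ∀ p, ∫ σ, c p * ‖chi p σ‖ ^ 2 ∂haarProb G = c p := fun p => by
    have h := inner_toL2_chiC p p
    rw [inner_toL2, if_pos rfl] at h
    simp only [chiC_apply, Complex.mul_conj, Complex.normSq_eq_norm_sq] at h
    rw [integral_complex_ofReal] at h
    rw [integral_const_mul, Complex.ofReal_eq_one.1 h, mul_one]
  have hcont : ∀ p : Dual G, Continuous fun σ => c p * ‖chi p σ‖ ^ 2 := fun p =>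
    continuous_const.mul ((chiC p).continuous.norm.pow 2)
  have hnorm : ∀ p σ, ‖c p * ‖chi p σ‖ ^ 2‖ = c p * ‖chi p σ‖ ^ 2 := fun p σ =>
    Real.norm_of_nonneg (mul_nonneg (hc p).le (sq_nonneg _))
  -- Since `chi p 1` is a positive integer, `c p` is at most the corresponding term of the expansion
  -- at `1`.
  have hsummable : Summable c := by
    refine (hFr 1).summable.of_nonneg_of_le (fun p => (hc p).le) fun p => ?_
    obtain ⟨d, hd0, hd, -⟩ := exists_chi_one p
    rw [hd, Complex.norm_natCast]
    exact le_mul_of_one_le_right (hc p).le (one_le_pow₀ (Nat.one_le_cast.2 hd0))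
  have hsum := hasSum_integral_of_summable_integral_norm (μ := haarProb G)
    (F := fun p σ => c p * ‖chi p σ‖ ^ 2) (fun p => integrable_of_continuous _ (hcont p))
    (by simpa only [hnorm, hint] using hsummable)
  simp only [hint, fun σ => (hFr σ).tsum_eq] at hsum
  refine hasTrace_of_hilbertBasis b (fun p => (hc p).le) (fun p => ?_) hsum
  rw [hb]
  refine Subtype.ext ?_
  change hunt ν (toL2 (chiC p)) = (c p : ℂ) • toL2 (chiC p)
  rw [hν.hunt_toL2_chiC, hνc]

end Density

end CentralSemigroup

theorem theorem5p3 {G : Type*} [Group G] [TopologicalSpace G] [IsTopologicalGroup G]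
    [CompactSpace G] [T2Space G] [MeasurableSpace G] [BorelSpace G]
    (μ : ℝ≥0 → ProbabilityMeasure G) (hμ : IsConvolutionSemigroup μ)
    (hcentral : ∀ t, IsCentral (μ t : Measure G))
    (hsymm : ∀ t, IsSymmetric (μ t : Measure G))
    (hL2 : ∀ t, 0 < t → HasL2Density (μ t : Measure G)) :
    ∃ α : Dual G → ℝ, (∀ p, α p ≤ 0) ∧
      (∀ (t : ℝ≥0) (π : Irrep G),
        measureFourier (μ t : Measure G) π = (Real.exp (t * α π.toDual) : ℂ) • 1) ∧
      ∀ t : ℝ≥0, 0 < t →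
        (∃! k : C(G, ℝ), IsDensity (μ t : Measure G) k) ∧
        ∀ k : C(G, ℝ), IsDensity (μ t : Measure G) k →
          (∀ σ ρ : G, HasSum
            (fun p : Dual G => (Real.exp (t * α p) : ℂ) * conj (chi p σ) * chi p ρ)
            ((∫ g, transitionDensity k (g⁻¹ * σ) (ρ * g⁻¹) ∂haarProb G : ℝ) : ℂ)) ∧
          HasTrace (huntCentral (μ t : Measure G) (hcentral t))
            ((∫ ρ, ∫ g, k (ρ⁻¹ * g * ρ * g⁻¹) ∂haarProb G ∂haarProb G : ℝ) : ℂ) := by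
  obtain ⟨α, hα0, hα⟩ := hμ.exists_exponent hcentral hsymm
  obtain ⟨b, hb⟩ := hμ.exists_hilbertBasis hcentral hsymm hL2
  refine ⟨α, hα0, fun t π => by rw [(hcentral t).measureFourier_eq, hα], fun t ht => ?_⟩
  -- Halving the time makes the density at `t` a convolution square of a function in `L²(G)`.
  obtain ⟨s, hs, rfl⟩ : ∃ s : ℝ≥0, 0 < s ∧ s + s = t := ⟨t / 2, half_pos ht, add_halves t⟩
  refine ⟨hμ.existsUnique_density (hsymm s) (hL2 s hs) (hL2 _ ht), fun k hk => ?_⟩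
  have hexpansion : ∀ σ ρ : G, HasSum
      (fun p : Dual G => (Real.exp ((s + s : ℝ≥0) * α p) : ℂ) * conj (chi p σ) * chi p ρ)
      ((∫ g, k (σ⁻¹ * (g * ρ * g⁻¹)) ∂haarProb G : ℝ) : ℂ) := fun σ ρ => by
    have h := hμ.hasSum_integral_density (hcentral s) (hsymm s) (hL2 s hs) (hL2 _ ht) b hb hk σ ρ
    refine h.congr_fun fun p => ?_
    rw [← hα, hμ.fourierScalar_add hcentral, sq]
  refine ⟨fun σ ρ => ?_, ?_⟩
  -- `(g⁻¹σ)⁻¹ρg⁻¹ = σ⁻¹gρg⁻¹`.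
  · simpa only [transitionDensity, mul_inv_rev, inv_inv, mul_assoc] using hexpansion σ ρ
  · have h := hasTrace_huntCentral (hcentral (s + s)) b hb (fun p => Real.exp_pos _)
      (fun p => hα (s + s) p) fun σ => hexpansion σ σ
    simpa only [mul_assoc] using h
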